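/- Let $\mathcal X$ be a finite alphabet; all logarithms are to the base $|\mathcal X|$. Let $\mathbf X=\{X_i\}_{i\in\mathbb Z}$ be a stationary ergodic process over $\mathcal X$, write $X_a^b=(X_a,\dots,X_b)$, and let $P_{X_a^b}$ be the probability mass function of $X_a^b$. **Reads.** Let $n\ge 1$ and $\ell\ge1$ be integers. Two random starting indices $I(1),I(2)$, independent of $\mathbf X$, are drawn as follows. $I(1)$ has an arbitrary law on $\{1,\dots,n\}$ (for instance the uniform one). Given $I(1)=i$, the index $I(2)$ is uniform on a window of $n$ consecutive integers: $\{i-\ell+1,\dots,i+n-\ell\}$ if $i\le \ell-1$; $\{1,\dots,n\}$ if $\ell\le i\le n-\ell+1$; $\{i+\ell-n,\dots,i+\ell-1\}$ if $i\ge n-\ell+2$. The noiseless reads are $R(j)=X_{I(j)}^{I(j)+\ell-1}$, $j=1,2$, and their signed overlap is $T=\max\{0,\ell-(I(2)-I(1))\}$ if $I(2)\ge I(1)$ and $T=-\max\{0,\ell-(I(1)-I(2))\}$ if $I(2)<I(1)$. The optimal Bayesian error is $$P^*_{\mathrm{error}}=\min_{\hat T}\ \mathbb P\big[\hat T(R(1),R(2))\ne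 T\big],$$ the minimum being over all maps $\hat T:\mathcal X^\ell\times\mathcal X^\ell\to\{-(\ell-1),\dots,\ell\}$. **Assumptions.** 1. The Rényi entropy rate of order $-\infty$ is finite: $\limsup_{t\to\infty}\frac{1}{2t+1}H_{-\infty}(P_{X_{-t}^t})<\infty$, where $H_{-\infty}(P)=-\log\min_{x\in\mathrm{supp}(P)}P(x)$. 2. $\sum_{s=0}^\infty d(s)<\infty$, where $d(s)$ is the supremum of $|\mathbb P[\mathcal F\mid\mathcal E]-\mathbb P[\mathcal F]|$ over all $i\in\mathbb Z$, all events $\mathcal E\in\sigma(X_j:j\le i)$ with $\mathbb P[\mathcal E]>0$ and all events $\mathcal F\in\sigma(X_j:j\ge i+s)$. 3. $\sup_{s\ge1}\mathbb P[X_1=X_{1+s}]<1$. 4. The Shannon entropy rate exists: $\mathcal H_1=\lim_{t\to\infty}\frac1{2t+1}H_1(P_{X_{-t}^t})$, where $H_1(P)=-\sum_xP(x)\log P(x)$. **Theorem.** Let $\beta>0$ and let the read length $\ell=\ell(n)$ be a sequence of integers with $\ell(n)/\log n\to\beta$ as $n\to\infty$ (for instance $\ell(n)=\lfloor\beta\log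 n\rfloor$). For each $n$ let the law of $I(1)$ on $\{1,\dots,n\}$ be given. Then $\mathcal H_1>0$ and, as $n\to\infty$, $$P^*_{\mathrm{error}}\le 2\,[1+o(1)]\cdot\min\Big\{\beta,\frac1{\mathcal H_1}\Big\}\cdot\frac{\log n}{n}.$$ -/

import Mathlib

open MeasureTheory ProbabilityTheory Filter Topology

noncomputable section

namespace OverlapDetection

/-! ### Two-sided random processes over a finite alphabet -/

section Processes

variable {Ω A : Type*} [MeasurableSpace Ω] [MeasurableSpace A]

/-- The left shift on two-sided sequences. -/
def shift (x : ℤ → A) : ℤ → A := fun i => x (i + 1)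

/-- The process `X` is stationary and ergodic: the shift preserves the law of the whole
two-sided sequence and is ergodic for it (`Ergodic` contains `MeasurePreserving`). -/
def IsStationaryErgodic (X : ℤ → Ω → A) (μ : Measure Ω) : Prop :=
  Ergodic (shift : (ℤ → A) → (ℤ → A)) (μ.map fun ω i => X i ω)

/-- The substring `X_i, X_{i+1}, …, X_{i+m-1}` of length `m`. -/
def read (X : ℤ → Ω → A) (m : ℕ) (i : ℤ) (ω : Ω) : Fin m → A := fun k => X (i + (k : ℕ)) ω

/-- The probability mass function of the window `X_{-t}, …, X_t`, a string of length `2 t + 1`. -/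
def windowPMF (X : ℤ → Ω → A) (μ : Measure Ω) (t : ℕ) (x : Fin (2 * t + 1) → A) : ℝ :=
  μ.real {ω | read X (2 * t + 1) (-(t : ℤ)) ω = x}

/-- The sigma-algebra generated by `X_j`, `j ≤ i`. -/
@[reducible] def pastAlgebra (X : ℤ → Ω → A) (i : ℤ) : MeasurableSpace Ω :=
  ⨆ j : Set.Iic i, MeasurableSpace.comap (X j) inferInstance

/-- The sigma-algebra generated by `X_j`, `j ≥ i`. -/
@[reducible] def futureAlgebra (X : ℤ → Ω → A) (i : ℤ) : MeasurableSpace Ω :=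
  ⨆ j : Set.Ici i, MeasurableSpace.comap (X j) inferInstance

/-- The strong mixing coefficient `d(s)`: the supremum of `|P[F | E] - P[F]|` over all times `i`,
all events `E` of positive probability determined by the process up to time `i`, and all events
`F` determined by the process from time `i + s` on. -/
def mixingCoeff (X : ℤ → Ω → A) (μ : Measure Ω) (s : ℕ) : ℝ :=
  sSup {r : ℝ | ∃ (i : ℤ) (E F : Set Ω), MeasurableSet[pastAlgebra X i] E ∧
    MeasurableSet[futureAlgebra X (i + s)] F ∧ μ E ≠ 0 ∧
    r = |(ProbabilityTheory.cond μ E).real F - μ.real F|}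

/-- The recurrence probability `sup_{s ≥ 1} P[X_1 = X_{1+s}]`. -/
def recurrenceProb (X : ℤ → Ω → A) (μ : Measure Ω) : ℝ :=
  ⨆ s : ℕ+, μ.real {ω | X 1 ω = X (1 + ((s : ℕ) : ℤ)) ω}

end Processes

/-! ### Entropies of probability mass functions, with logarithms to the base `b` -/

section Entropy

/-- The Shannon entropy `-∑ P(x) log_b P(x)`. -/
def shannonEntropy {S : Type*} [Fintype S] (b : ℝ) (P : S → ℝ) : ℝ :=
  -∑ x, P x * Real.logb b (P x)

/-- The Rényi entropy of order minus infinity, `-log_b min {P(x) : x in the support of P}`. -/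
def minusInfEntropy {S : Type*} (b : ℝ) (P : S → ℝ) : ℝ :=
  -Real.logb b (sInf (P '' Function.support P))

variable {Ω A : Type*} [MeasurableSpace Ω] [MeasurableSpace A] [Fintype A]

/-- `H` is the Shannon entropy rate of the process, i.e. the limit of
`H_1(P_{X_{-t}^t}) / (2 t + 1)`; the base of the logarithm is the alphabet size. -/
def HasShannonRate (X : ℤ → Ω → A) (μ : Measure Ω) (H : ℝ) : Prop :=
  Tendsto (fun t : ℕ =>
    shannonEntropy (Fintype.card A : ℝ) (windowPMF X μ t) / (2 * (t : ℝ) + 1)) atTop (𝓝 H)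

/-- The (upper) Rényi entropy rate of order minus infinity, with values in `[-∞, ∞]`; it is the
limit of `H_{-∞}(P_{X_{-t}^t}) / (2 t + 1)` whenever that limit exists. -/
def minusInfRate (X : ℤ → Ω → A) (μ : Measure Ω) : EReal :=
  limsup (fun t : ℕ =>
    ((minusInfEntropy (Fintype.card A : ℝ) (windowPMF X μ t) / (2 * (t : ℝ) + 1) : ℝ) : EReal))
    atTop

end Entropy

/-! ### Sampling of two reads and detection of their overlap -/

section Detection

/-- The signed overlap of two reads of length `l` that start at `i₁` and `i₂`. -/
def signedOverlap (l : ℕ) (i₁ i₂ : ℤ) : ℤ :=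
  if i₁ ≤ i₂ then max 0 ((l : ℤ) - (i₂ - i₁)) else -max 0 ((l : ℤ) - (i₁ - i₂))

/-- The possible values `{-(l-1), …, -1} ∪ {0} ∪ {1, …, l}` of the signed overlap. -/
def overlapValues (l : ℕ) : Finset ℤ := insert 0 (Finset.Icc (1 - (l : ℤ)) l)

/-- The window of `n` positions from which the second starting index is drawn uniformly, given
that the first starting index is `i ∈ {1, …, n}`. -/
def secondWindow (n l : ℕ) (i : ℤ) : Finset ℤ :=
  if i ≤ (l : ℤ) - 1 then Finset.Icc (i + (1 - (l : ℤ))) (i + ((n : ℤ) - l))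
  else if i ≤ (n : ℤ) - l + 1 then Finset.Icc 1 (n : ℤ)
  else Finset.Icc (i + ((l : ℤ) - n)) (i + ((l : ℤ) - 1))

/-- An overlap detector for two noiseless reads of length `l`. -/
abbrev Detector (A : Type*) (l : ℕ) : Type _ :=
  (Fin l → A) → (Fin l → A) → overlapValues l

variable {Ω A : Type*} [MeasurableSpace Ω] [MeasurableSpace A]

/-- The Bayesian error probability `P[D(read₁, read₂) ≠ T]` of the detector `D`. The starting
indices are independent of the process; the first equals `i ∈ {1, …, n}` with probability `q i`,
and the second is then uniform on the `n` positions of `secondWindow n l i`. -/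
def errorProb (X : ℤ → Ω → A) (μ : Measure Ω) (n l : ℕ) (q : ℤ → ℝ) (D : Detector A l) : ℝ :=
  ∑ i ∈ Finset.Icc 1 (n : ℤ), q i * ∑ j ∈ secondWindow n l i, (1 / (n : ℝ)) *
    μ.real {ω | (D (read X l i ω) (read X l j ω) : ℤ) ≠ signedOverlap l i j}

/-- The minimal Bayesian error probability over the (finitely many, when the alphabet is finite)
detectors. -/
def optimalError (X : ℤ → Ω → A) (μ : Measure Ω) (n l : ℕ) (q : ℤ → ℝ) : ℝ :=
  ⨅ D : Detector A l, errorProb X μ n l q D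

end Detection

end OverlapDetection

end

/-! Two detectors give the two terms of the minimum. The detector that always answers `0` errs only
if the reads overlap, that is for at most `2 * l` second starts, hence with probability at most `2 *
l / n`.

The other detector looks for a shift under which the first `τ` symbols of the overlap agree and form
a word of a typical set `W`, with `τ` slightly larger than `log n / H`. It gives up on the at most
`2 * τ` second starts whose overlap is positive but shorter than `τ`; these produce the main term `2
* τ / n`. Elsewhere it errs only if the overlap word is atypical or if a false shift passes the
test. There are at most `2 * l + 1` shifts, so it suffices that each contributes `o(1)` to the error
summed over the second start; the remaining terms are then `o(log n / n)`.

For a false shift the two compared words sit at distinct positions. Far apart, mixing bounds the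
probability of agreement by a mixing coefficient plus `θ`, the largest probability of a word of `W`.
The mixing coefficients are summable, and `n * θ` vanishes because typical words have probability at
most `b ^ (-τ * (H - ε))`, less than a power `n ^ (-1 - δ')`. Close together, agreement forces
periodicity, which is exponentially unlikely in `τ` (`exists_exponential_bounds`). These estimates
are combined in `optimalError_le_of_typical`.

Only the half of the equipartition property that says words are rarely too likely is needed
(`tendsto_measureReal_lt_windowPMF`). Comparison with independent blocks shows that the information
rate is rarely above `H + η`. Its mean tends to `H` and it is bounded, by the Rényi assumption, so
it cannot be noticeably below `H` with non-vanishing probability. -/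

set_option linter.unusedSectionVars false

noncomputable section

namespace OverlapDetection

/-! ### Mixing as approximate independence of past and future -/

section Mixing

variable {Ω A : Type*} [MeasurableSpace Ω] [MeasurableSpace A]
  {μ : Measure Ω} {X : ℤ → Ω → A}

lemma measurableSet_pastAlgebra {i j : ℤ} (h : j ≤ i) {s : Set A} (hs : MeasurableSet s) :
    MeasurableSet[pastAlgebra X i] (X j ⁻¹' s) := by
  have : MeasurableSpace.comap (X j) inferInstance ≤ pastAlgebra X i :=
    le_iSup (fun j : Set.Iic i => MeasurableSpace.comap (X j) inferInstance) ⟨j, h⟩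
  exact this _ ⟨s, hs, rfl⟩

lemma measurableSet_futureAlgebra {i j : ℤ} (h : i ≤ j) {s : Set A} (hs : MeasurableSet s) :
    MeasurableSet[futureAlgebra X i] (X j ⁻¹' s) := by
  have : MeasurableSpace.comap (X j) inferInstance ≤ futureAlgebra X i :=
    le_iSup (fun j : Set.Ici i => MeasurableSpace.comap (X j) inferInstance) ⟨j, h⟩
  exact this _ ⟨s, hs, rfl⟩

lemma pastAlgebra_mono {i j : ℤ} (h : i ≤ j) : pastAlgebra X i ≤ pastAlgebra X j :=
  iSup_le fun k => le_iSup (fun k : Set.Iic j => MeasurableSpace.comap (X k) inferInstance)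
    ⟨k, le_trans k.2 h⟩

lemma pastAlgebra_le (hX : ∀ i, Measurable (X i)) (i : ℤ) :
    pastAlgebra X i ≤ (inferInstance : MeasurableSpace Ω) :=
  iSup_le fun k => (hX k).comap_le

lemma setOf_read_eq (m : ℕ) (a : ℤ) (x : Fin m → A) :
    {ω | read X m a ω = x} = ⋂ k : Fin m, X (a + (k : ℕ)) ⁻¹' {x k} := by
  ext ω
  simp [read, funext_iff]

lemma measurableSet_past_read [MeasurableSingletonClass A] {m : ℕ} {a i : ℤ} (h : a + m ≤ i + 1)
    (x : Fin m → A) : MeasurableSet[pastAlgebra X i] {ω | read X m a ω = x} := by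
  rw [setOf_read_eq]
  refine MeasurableSet.iInter fun k => measurableSet_pastAlgebra ?_ (measurableSet_singleton _)
  have := k.2
  omega

lemma measurableSet_future_read [MeasurableSingletonClass A] {m : ℕ} {a i : ℤ} (h : i ≤ a)
    (x : Fin m → A) : MeasurableSet[futureAlgebra X i] {ω | read X m a ω = x} := by
  rw [setOf_read_eq]
  refine MeasurableSet.iInter fun k => measurableSet_futureAlgebra ?_ (measurableSet_singleton _)
  omega

lemma measurable_read (hX : ∀ i, Measurable (X i)) (m : ℕ) (a : ℤ) : Measurable (read X m a) :=
  measurable_pi_lambda _ fun _ => hX _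

lemma mixingCoeff_nonneg (s : ℕ) : 0 ≤ mixingCoeff X μ s := by
  refine Real.sSup_nonneg ?_
  rintro r ⟨i, E, F, -, -, -, rfl⟩
  exact abs_nonneg _

lemma abs_cond_sub_le_mixingCoeff [IsProbabilityMeasure μ] {i : ℤ} {s : ℕ} {E F : Set Ω}
    (hE : MeasurableSet[pastAlgebra X i] E) (hF : MeasurableSet[futureAlgebra X (i + s)] F)
    (h0 : μ E ≠ 0) : |(ProbabilityTheory.cond μ E).real F - μ.real F| ≤ mixingCoeff X μ s := by
  refine le_csSup ⟨1, ?_⟩ ⟨i, E, F, hE, hF, h0, rfl⟩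
  rintro r ⟨i, E, F, -, -, h0, rfl⟩
  have := ProbabilityTheory.cond_isProbabilityMeasure h0
  have h1 : (ProbabilityTheory.cond μ E).real F ≤ 1 := measureReal_le_one
  have h2 : μ.real F ≤ 1 := measureReal_le_one
  have h3 : 0 ≤ (ProbabilityTheory.cond μ E).real F := measureReal_nonneg
  have h4 : 0 ≤ μ.real F := measureReal_nonneg
  rw [abs_le]
  constructor <;> linarith

/-- The factor `μ.real E` in the error is essential: summed over a partition into past events, the
errors add up to one mixing coefficient, whatever the number of words. -/
lemma abs_measureReal_inter_sub_le [IsProbabilityMeasure μ] (hX : ∀ i, Measurable (X i))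
    {i j : ℤ} {s : ℕ} (hij : i + s ≤ j) {E F : Set Ω}
    (hE : MeasurableSet[pastAlgebra X i] E) (hF : MeasurableSet[futureAlgebra X j] F) :
    |μ.real (E ∩ F) - μ.real E * μ.real F| ≤ μ.real E * mixingCoeff X μ s := by
  by_cases h0 : μ E = 0
  · have h1 : μ (E ∩ F) = 0 := measure_mono_null Set.inter_subset_left h0
    simp [measureReal_def, h0, h1]
  have hF' : MeasurableSet[futureAlgebra X (i + s)] F := by
    refine (iSup_le fun k => ?_ : futureAlgebra X j ≤ futureAlgebra X (i + s)) _ hF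
    exact le_iSup (fun k : Set.Ici (i + s : ℤ) => MeasurableSpace.comap (X k) inferInstance)
      ⟨k, le_trans hij k.2⟩
  have h := abs_cond_sub_le_mixingCoeff (μ := μ) hE hF' h0
  have hpos : 0 < μ.real E := by
    rw [measureReal_def]
    exact ENNReal.toReal_pos h0 (measure_ne_top _ _)
  have hc : (ProbabilityTheory.cond μ E).real F = (μ.real E)⁻¹ * μ.real (E ∩ F) := by
    rw [measureReal_def, cond_apply (pastAlgebra_le hX i _ hE), ENNReal.toReal_mul,
      ENNReal.toReal_inv]
    rfl
  have he : μ.real (E ∩ F) - μ.real E * μ.real F =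
      μ.real E * ((ProbabilityTheory.cond μ E).real F - μ.real F) := by
    rw [hc]
    field_simp
  rw [he, abs_mul, abs_of_pos hpos]
  exact mul_le_mul_of_nonneg_left h hpos.le

lemma measureReal_inter_le [IsProbabilityMeasure μ] (hX : ∀ i, Measurable (X i))
    {i j : ℤ} {s : ℕ} (hij : i + s ≤ j) {E F : Set Ω}
    (hE : MeasurableSet[pastAlgebra X i] E) (hF : MeasurableSet[futureAlgebra X j] F) :
    μ.real (E ∩ F) ≤ μ.real E * (μ.real F + mixingCoeff X μ s) := by
  have := (abs_le.1 (abs_measureReal_inter_sub_le (μ := μ) hX hij hE hF)).2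
  linarith

end Mixing

/-! ### Shift invariance of word probabilities -/

section Stationarity

variable {Ω A : Type*} [MeasurableSpace Ω] [MeasurableSpace A] [MeasurableSingletonClass A]
  {μ : Measure Ω} {X : ℤ → Ω → A}

lemma measureReal_read_succ (hX : ∀ i, Measurable (X i)) (hstat : IsStationaryErgodic X μ)
    (m : ℕ) (a : ℤ) (x : Fin m → A) :
    μ.real {ω | read X m (a + 1) ω = x} = μ.real {ω | read X m a ω = x} := by
  have hY : Measurable fun ω i => X i ω := measurable_pi_lambda _ hX
  have hS : MeasurableSet {y : ℤ → A | ∀ k : Fin m, y (a + (k : ℕ)) = x k} := by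
    rw [Set.ofPred_forall]
    exact MeasurableSet.iInter fun k => measurable_pi_apply _ (measurableSet_singleton _)
  have hp := hstat.toMeasurePreserving.measure_preimage hS.nullMeasurableSet
  rw [Measure.map_apply hY (hstat.measurable hS), Measure.map_apply hY hS] at hp
  rw [measureReal_def, measureReal_def]
  congr 1
  convert hp using 2
  · ext ω
    simp only [read, funext_iff, Set.mem_ofPred_eq, Set.mem_preimage, shift]
    refine forall_congr' fun k => ?_
    rw [add_right_comm]
  · ext ω
    simp [read, funext_iff]

lemma measureReal_read_eq (hX : ∀ i, Measurable (X i)) (hstat : IsStationaryErgodic X μ)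
    (m : ℕ) (a b : ℤ) (x : Fin m → A) :
    μ.real {ω | read X m a ω = x} = μ.real {ω | read X m b ω = x} := by
  have key : ∀ c : ℤ, μ.real {ω | read X m c ω = x} = μ.real {ω | read X m 0 ω = x} := by
    intro c
    induction c using Int.induction_on with
    | zero => rfl
    | succ i ih => rw [measureReal_read_succ hX hstat, ih]
    | pred i ih =>
      rw [← ih, ← measureReal_read_succ hX hstat, sub_add_cancel]
  rw [key a, key b]

lemma measureReal_preimage_eq (hX : ∀ i, Measurable (X i)) (hstat : IsStationaryErgodic X μ)
    (i j : ℤ) (a : A) : μ.real (X i ⁻¹' {a}) = μ.real (X j ⁻¹' {a}) := by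
  have h : ∀ i, X i ⁻¹' {a} = {ω | read X 1 i ω = fun _ => a} := fun i => by
    ext ω
    simp [read, funext_iff]
  rw [h, h, measureReal_read_eq hX hstat 1 i j]

end Stationarity

/-! ### Exponential decay of word and self-coincidence probabilities -/

section Decay

variable {Ω A : Type*} [MeasurableSpace Ω] [MeasurableSpace A] [MeasurableSingletonClass A]
  {μ : Measure Ω} [IsProbabilityMeasure μ] {X : ℤ → Ω → A}

/-- By mixing, the probability that `a` occurs at times `1` and `1 + s` tends to the square on the
left, and each such event is a recurrence. Thus no symbol is almost certain. -/
lemma sq_measureReal_preimage_le (hX : ∀ i, Measurable (X i)) (hstat : IsStationaryErgodic X μ)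
    (hmix : Tendsto (mixingCoeff X μ) atTop (𝓝 0)) (i : ℤ) (a : A) :
    μ.real (X i ⁻¹' {a}) ^ 2 ≤ recurrenceProb X μ := by
  have hlim : Tendsto (fun s : ℕ => μ.real (X i ⁻¹' {a}) ^ 2 -
      μ.real (X i ⁻¹' {a}) * mixingCoeff X μ s) atTop (𝓝 (μ.real (X i ⁻¹' {a}) ^ 2)) := by
    simpa using tendsto_const_nhds.sub (hmix.const_mul _)
  refine le_of_tendsto hlim ?_
  filter_upwards [eventually_ge_atTop 1] with s hs
  have h := abs_measureReal_inter_sub_le (μ := μ) hX (le_refl ((1 : ℤ) + s))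
    (measurableSet_pastAlgebra (X := X) (le_refl 1) (measurableSet_singleton a))
    (measurableSet_futureAlgebra (X := X) (le_refl ((1 : ℤ) + s)) (measurableSet_singleton a))
  rw [measureReal_preimage_eq hX hstat 1 i, measureReal_preimage_eq hX hstat (1 + s) i] at h
  have h1 := (abs_le.1 h).1
  have h2 : μ.real (X 1 ⁻¹' {a} ∩ X (1 + s) ⁻¹' {a}) ≤
      μ.real {ω | X 1 ω = X (1 + (s : ℤ)) ω} := by
    refine measureReal_mono ?_
    rintro ω ⟨h1, h2⟩
    simp only [Set.mem_preimage, Set.mem_singleton_iff, Set.mem_ofPred_eq] at *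
    rw [h1, h2]
  have h3 : μ.real {ω | X 1 ω = X (1 + (s : ℤ)) ω} ≤ recurrenceProb X μ := by
    refine le_ciSup (f := fun s : ℕ+ => μ.real {ω | X 1 ω = X (1 + ((s : ℕ) : ℤ)) ω})
      ⟨1, ?_⟩ ⟨s, hs⟩
    rintro _ ⟨s, rfl⟩
    exact measureReal_le_one
  nlinarith

/-- Along an arithmetic progression of large step `g`, every prescribed string is exponentially
unlikely, whatever the past. -/
lemma exists_measureReal_inter_le_pow (hX : ∀ i, Measurable (X i))
    (hstat : IsStationaryErgodic X μ) (hmix : Tendsto (mixingCoeff X μ) atTop (𝓝 0))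
    (haper : recurrenceProb X μ < 1) :
    ∃ (g : ℕ) (r : ℝ), 0 < g ∧ 0 < r ∧ r < 1 ∧ ∀ (i : ℤ) (E : Set Ω) (w : ℕ → A) (m : ℕ),
      MeasurableSet[pastAlgebra X i] E →
      μ.real (E ∩ ⋂ j ∈ Finset.range m, X (i + ((j + 1) * g : ℕ)) ⁻¹' {w j}) ≤
        r ^ m * μ.real E := by
  set ρ := √(recurrenceProb X μ) with hρ
  have hρ1 : ρ < 1 := by
    rw [hρ, Real.sqrt_lt' one_pos]
    simpa using haper
  have hρ0 : 0 ≤ ρ := Real.sqrt_nonneg _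
  have hle : ∀ i a, μ.real (X i ⁻¹' {a}) ≤ ρ := fun i a =>
    Real.le_sqrt_of_sq_le (sq_measureReal_preimage_le hX hstat hmix i a)
  obtain ⟨g, hg, hg0⟩ := ((hmix.eventually (gt_mem_nhds (show 0 < (1 - ρ) / 2 by linarith))).and
    (eventually_gt_atTop 0)).exists
  -- The ratio is the midpoint of `ρ` and `1`: a prescribed symbol, `g` steps after the past, has
  -- conditional probability at most `ρ` plus a mixing coefficient below `(1 - ρ) / 2`.
  refine ⟨g, ρ + (1 - ρ) / 2, hg0, by linarith, by linarith, fun i E w m hE => ?_⟩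
  induction m with
  | zero => simp
  | succ m ih =>
    set E' := E ∩ ⋂ j ∈ Finset.range m, X (i + ((j + 1) * g : ℕ)) ⁻¹' {w j} with hE'
    have hsplit : E ∩ ⋂ j ∈ Finset.range (m + 1), X (i + ((j + 1) * g : ℕ)) ⁻¹' {w j} =
        E' ∩ X (i + ((m + 1) * g : ℕ)) ⁻¹' {w m} := by
      rw [hE', Finset.range_add_one, Finset.set_biInter_insert, Set.inter_assoc,
        Set.inter_comm (X _ ⁻¹' _)]
    have hE'm : MeasurableSet[pastAlgebra X (i + (m * g : ℕ))] E' := by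
      refine MeasurableSet.inter (pastAlgebra_mono (by omega) _ hE) ?_
      refine Finset.measurableSet_biInter _ fun j hj => ?_
      refine measurableSet_pastAlgebra ?_ (measurableSet_singleton _)
      have : (j + 1) * g ≤ m * g := Nat.mul_le_mul_right _ (Finset.mem_range.1 hj)
      omega
    rw [hsplit]
    have h := measureReal_inter_le (μ := μ) hX (s := g) (j := i + ((m + 1) * g : ℕ))
      (by push_cast; linarith) hE'm
      (measurableSet_futureAlgebra (X := X) le_rfl (measurableSet_singleton (w m)))
    refine h.trans ?_
    have h1 := hle (i + ((m + 1) * g : ℕ)) (w m)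
    have h2 : (0 : ℝ) ≤ μ.real E' := measureReal_nonneg
    calc μ.real E' * (μ.real (X (i + ((m + 1) * g : ℕ)) ⁻¹' {w m}) + mixingCoeff X μ g)
        ≤ μ.real E' * (ρ + (1 - ρ) / 2) := mul_le_mul_of_nonneg_left (by linarith) h2
      _ ≤ ((ρ + (1 - ρ) / 2) ^ m * μ.real E) * (ρ + (1 - ρ) / 2) :=
        mul_le_mul_of_nonneg_right ih (by linarith)
      _ = _ := by ring

/-- Strings of length `τ`, and coincidences of two distinct substrings of length `τ`, have
exponentially small probability. -/
lemma exists_exponential_bounds [Fintype A] (hX : ∀ i, Measurable (X i))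
    (hstat : IsStationaryErgodic X μ) (hmix : Tendsto (mixingCoeff X μ) atTop (𝓝 0))
    (haper : recurrenceProb X μ < 1) :
    ∃ (g : ℕ) (r : ℝ), 0 < g ∧ 0 < r ∧ r < 1 ∧
      (∀ (τ : ℕ) (a : ℤ) (x : Fin τ → A), μ.real {ω | read X τ a ω = x} ≤ r ^ (τ / g)) ∧
      ∀ (τ : ℕ) (a b : ℤ), a < b →
        μ.real {ω | read X τ a ω = read X τ b ω} ≤ r ^ (τ / g) := by
  obtain ⟨g, r, hg, hr0, hr1, h⟩ := exists_measureReal_inter_le_pow hX hstat hmix haper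
  -- the two claims are both instances of the following bound
  have key : ∀ (τ : ℕ) (b : ℤ) (E : Set Ω) (M : Set Ω), MeasurableSet[pastAlgebra X (b - 1)] E →
      (∀ ω ∈ E ∩ M, ∀ ω' ∈ E ∩ M, ∀ k < τ, X (b + k) ω = X (b + k) ω') →
      μ.real (E ∩ M) ≤ r ^ (τ / g) * μ.real E := by
    intro τ b E M hE hM
    rcases (E ∩ M).eq_empty_or_nonempty with h0 | ⟨ω₀, hω₀⟩
    · rw [h0, measureReal_empty]
      positivity
    refine le_trans (measureReal_mono ?_) (h (b - 1) E
      (fun j => X (b - 1 + ((j + 1) * g : ℕ)) ω₀) (τ / g) hE)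
    intro ω hω
    refine ⟨hω.1, ?_⟩
    simp only [Set.mem_iInter, Set.mem_preimage, Set.mem_singleton_iff, Finset.mem_range]
    intro j hj
    have h1 : (j + 1) * g ≤ τ := (Nat.mul_le_mul_right g hj).trans (Nat.div_mul_le_self τ g)
    have h2 : 0 < (j + 1) * g := by positivity
    have h3 := hM ω hω ω₀ hω₀ ((j + 1) * g - 1) (by omega)
    have h4 : b - 1 + ((j + 1) * g : ℕ) = b + (((j + 1) * g - 1 : ℕ) : ℤ) := by omega
    rw [h4]
    exact h3
  refine ⟨g, r, hg, hr0, hr1, fun τ a x => ?_, fun τ a b hab => ?_⟩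
  · have h1 := key τ a Set.univ {ω | read X τ a ω = x} MeasurableSet.univ ?_
    · simpa using h1
    · rintro ω ⟨-, hω⟩ ω' ⟨-, hω'⟩ k hk
      exact congrFun (hω.trans hω'.symm) ⟨k, hk⟩
  · set u := (b - a).toNat with hu
    have hb : b = a + u := by omega
    have hu0 : 0 < u := by omega
    set M := {ω | read X τ a ω = read X τ b ω} with hMdef
    have hpart : ∀ S : Set Ω, MeasurableSet S →
        ∑ x : Fin u → A, μ.real ({ω | read X u a ω = x} ∩ S) = μ.real S := by
      intro S hS
      have h1 := sum_measureReal_preimage_singleton (μ := μ.restrict S)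
        (Finset.univ : Finset (Fin u → A)) (f := read X u a)
        (fun x _ => measurable_read hX u a (measurableSet_singleton x))
      simp only [Finset.coe_univ, Set.preimage_univ] at h1
      rw [measureReal_restrict_apply MeasurableSet.univ, Set.univ_inter] at h1
      rw [← h1]
      refine Finset.sum_congr rfl fun x _ => ?_
      rw [measureReal_restrict_apply (measurable_read hX u a (measurableSet_singleton x))]
      rfl
    have hMm : MeasurableSet M :=
      measurableSet_eq_fun (measurable_read hX τ a) (measurable_read hX τ b)
    have h1 := hpart M hMm
    have h2 := hpart Set.univ MeasurableSet.univ
    simp only [Set.inter_univ, probReal_univ] at h2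
    rw [← h1]
    calc ∑ x : Fin u → A, μ.real ({ω | read X u a ω = x} ∩ M)
        ≤ ∑ x : Fin u → A, r ^ (τ / g) * μ.real {ω | read X u a ω = x} := by
          refine Finset.sum_le_sum fun x _ => key τ b _ M
            (measurableSet_past_read (by omega) x) ?_
          rintro ω ⟨hω, hωM⟩ ω' ⟨hω', hωM'⟩
          -- On `M` the sequence has period `u` from `a` on, so its first `u` symbols determine the
          -- whole word at `b`, even when the two substrings overlap.
          have hall : ∀ k, k < u + τ → X (a + k) ω = X (a + k) ω' := by
            intro k
            induction k using Nat.strong_induction_on with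
            | _ k ih =>
              intro hk
              by_cases hku : k < u
              · exact congrFun (hω.trans hω'.symm) ⟨k, hku⟩
              · have e1 := congrFun hωM ⟨k - u, by omega⟩
                have e2 := congrFun hωM' ⟨k - u, by omega⟩
                have e3 := ih (k - u) (by omega) (by omega)
                have e4 : b + ((k - u : ℕ) : ℤ) = a + k := by omega
                simp only [read, e4] at e1 e2
                rw [← e1, ← e2, e3]
          intro k hk
          have := hall (u + k) (by omega)
          rwa [show a + ((u + k : ℕ) : ℤ) = b + k by push_cast; omega] at this
      _ = r ^ (τ / g) := by rw [← Finset.mul_sum, h2, mul_one]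

end Decay

/-! ### Finite-valued random variables -/

section FiniteValued

variable {Ω S : Type*} [MeasurableSpace Ω] {μ : Measure Ω} [IsProbabilityMeasure μ]
  [Fintype S] [MeasurableSpace S] [MeasurableSingletonClass S] {U : Ω → S}

lemma integrable_comp_of_finite (hU : Measurable U) (φ : S → ℝ) :
    Integrable (fun ω => φ (U ω)) μ := by
  have := Measure.isProbabilityMeasure_map (μ := μ) hU.aemeasurable
  exact (Integrable.of_finite (f := φ) (μ := μ.map U)).comp_measurable hU

lemma integral_comp_of_finite (hU : Measurable U) (φ : S → ℝ) :
    ∫ ω, φ (U ω) ∂μ = ∑ x, μ.real {ω | U ω = x} * φ x := by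
  have := Measure.isProbabilityMeasure_map (μ := μ) hU.aemeasurable
  rw [← integral_map hU.aemeasurable (measurable_of_finite φ).aestronglyMeasurable,
    integral_fintype Integrable.of_finite]
  refine Finset.sum_congr rfl fun x _ => ?_
  rw [map_measureReal_apply hU (measurableSet_singleton x), smul_eq_mul]
  rfl

lemma measureReal_mem_eq_sum (hU : Measurable U) (p : S → Prop) [DecidablePred p] :
    μ.real {ω | p (U ω)} = ∑ x with p x, μ.real {ω | U ω = x} := by
  have h := sum_measureReal_preimage_singleton (μ := μ) (Finset.univ.filter p) (f := U)
    (fun x _ => hU (measurableSet_singleton x))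
  have h2 : U ⁻¹' ↑(Finset.univ.filter p) = {ω | p (U ω)} := by
    ext ω
    simp
  rw [h2] at h
  exact h.symm

lemma sum_measureReal_eq_one (hU : Measurable U) : ∑ x, μ.real {ω | U ω = x} = 1 := by
  have h := measureReal_mem_eq_sum (μ := μ) hU fun _ => True
  have h2 : {ω : Ω | True} = Set.univ := by ext; simp
  rw [h2] at h
  simpa using h.symm

end FiniteValued

/-- A sum over integers of a function of the distance to `c` is at most twice its total mass. -/
lemma sum_natAbs_sub_le (S : Finset ℤ) (c : ℤ) {F : ℕ → ℝ} (h0 : ∀ k, 0 ≤ F k)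
    (hF : Summable F) : ∑ j ∈ S, F (j - c).natAbs ≤ 2 * ∑' k, F k := by
  have half : ∀ T : Finset ℤ, Set.InjOn (fun j : ℤ => (j - c).natAbs) T →
      ∑ j ∈ T, F (j - c).natAbs ≤ ∑' k, F k := by
    intro T hT
    rw [← Finset.sum_image (f := F) (g := fun j : ℤ => (j - c).natAbs) hT]
    exact hF.sum_le_tsum _ fun k _ => h0 k
  rw [← Finset.sum_filter_add_sum_filter_not S (fun j => c ≤ j), two_mul]
  refine add_le_add (half _ ?_) (half _ ?_)
  · intro x hx y hy hxy
    simp only [Finset.coe_filter, Set.mem_ofPred_eq] at hx hy hxy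
    omega
  · intro x hx y hy hxy
    simp only [Finset.coe_filter, Set.mem_ofPred_eq] at hx hy hxy
    omega

/-! ### Entropy rate and equipartition -/

section Entropy

variable {Ω A : Type*} [MeasurableSpace Ω] [Fintype A] [MeasurableSpace A]
  [MeasurableSingletonClass A] {μ : Measure Ω} [IsProbabilityMeasure μ] {X : ℤ → Ω → A}

/-- Weak law of large numbers for functions of consecutive blocks. -/
lemma tendsto_measureReal_block_sum (hX : ∀ i, Measurable (X i))
    (hstat : IsStationaryErgodic X μ) (hmix : Summable (mixingCoeff X μ)) {k : ℕ} (hk : 0 < k)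
    (f : (Fin k → A) → ℝ) {η : ℝ} (hη : 0 < η) :
    Tendsto (fun m : ℕ => μ.real {ω | m * (∑ x, μ.real {ω | read X k 0 ω = x} * f x) + m * η ≤
      ∑ j ∈ Finset.range m, f (read X k ((j * k : ℕ) : ℤ) ω)}) atTop (𝓝 0) := by
  set P : (Fin k → A) → ℝ := fun x => μ.real {ω | read X k 0 ω = x} with hP
  set e := ∑ x, P x * f x with he
  have hPsum : ∑ x, P x = 1 := sum_measureReal_eq_one (measurable_read hX k 0)
  have hP0 : ∀ x, 0 ≤ P x := fun x => measureReal_nonneg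
  set g : (Fin k → A) → ℝ := fun x => f x - e with hg
  have hPg : ∑ x, P x * g x = 0 := by
    simp only [hg, mul_sub, Finset.sum_sub_distrib, ← Finset.sum_mul, hPsum, ← he]
    ring
  set K := (∑ x, |g x|) ^ 2 with hK
  have hK0 : 0 ≤ K := sq_nonneg _
  set W : ℕ → Ω → ℝ := fun j ω => g (read X k ((j * k : ℕ) : ℤ) ω) with hW
  have hgle : ∀ x, |g x| ≤ ∑ x, |g x| := fun x =>
    Finset.single_le_sum (f := fun x => |g x|) (fun _ _ => abs_nonneg _) (Finset.mem_univ x)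
  have hpair : ∀ i j, Measurable fun ω =>
      (read X k ((i * k : ℕ) : ℤ) ω, read X k ((j * k : ℕ) : ℤ) ω) := fun i j =>
    (measurable_read hX _ _).prodMk (measurable_read hX _ _)
  have hint : ∀ i j, Integrable (fun ω => W i ω * W j ω) μ := fun i j =>
    integrable_comp_of_finite (hpair i j) fun p => g p.1 * g p.2
  have hdiag : ∀ i, ∫ ω, W i ω * W i ω ∂μ ≤ K := by
    intro i
    have : ∫ ω, W i ω * W i ω ∂μ ≤ ∫ _, K ∂μ := by
      refine integral_mono (hint i i) (integrable_const _) fun ω => ?_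
      have h1 := hgle (read X k ((i * k : ℕ) : ℤ) ω)
      have h2 : W i ω * W i ω = |g (read X k ((i * k : ℕ) : ℤ) ω)| ^ 2 := by
        rw [sq_abs, sq]
      change W i ω * W i ω ≤ K
      rw [h2]
      exact pow_le_pow_left₀ (abs_nonneg _) h1 2
    simpa using this
  -- Centring makes the product of the means zero, so the covariance is controlled by the mixing
  -- coefficient across the gap between the blocks.
  have hoff : ∀ i j, i < j → ∫ ω, W i ω * W j ω ∂μ ≤ K * mixingCoeff X μ (j - i - 1) := by
    intro i j hij
    have h1 := integral_comp_of_finite (μ := μ) (hpair i j) fun p => g p.1 * g p.2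
    rw [Fintype.sum_prod_type] at h1
    have h2 : ∑ x, ∑ y, P x * P y * (g x * g y) = 0 := by
      have : ∑ x, ∑ y, P x * P y * (g x * g y) = (∑ x, P x * g x) * ∑ y, P y * g y := by
        rw [Finset.sum_mul_sum]
        refine Finset.sum_congr rfl fun x _ => Finset.sum_congr rfl fun y _ => by ring
      rw [this, hPg, zero_mul]
    have h3 : ∫ ω, W i ω * W j ω ∂μ = ∑ x, ∑ y, μ.real {ω | (read X k ((i * k : ℕ) : ℤ) ω,
        read X k ((j * k : ℕ) : ℤ) ω) = (x, y)} * (g x * g y) := h1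
    have h4 : K * mixingCoeff X μ (j - i - 1) =
        ∑ x, ∑ y, mixingCoeff X μ (j - i - 1) * (|g x| * |g y|) := by
      rw [hK, sq, Finset.sum_mul_sum, mul_comm, Finset.mul_sum]
      refine Finset.sum_congr rfl fun x _ => ?_
      rw [Finset.mul_sum]
    rw [← sub_zero (∫ ω, W i ω * W j ω ∂μ), ← h2, h3, h4, ← Finset.sum_sub_distrib]
    refine Finset.sum_le_sum fun x _ => ?_
    rw [← Finset.sum_sub_distrib]
    refine Finset.sum_le_sum fun y _ => ?_
    rw [← sub_mul, ← abs_mul]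
    refine (le_abs_self _).trans ?_
    rw [abs_mul]
    refine mul_le_mul_of_nonneg_right ?_ (abs_nonneg _)
    have hset : {ω | (read X k ((i * k : ℕ) : ℤ) ω, read X k ((j * k : ℕ) : ℤ) ω) = (x, y)} =
        {ω | read X k ((i * k : ℕ) : ℤ) ω = x} ∩ {ω | read X k ((j * k : ℕ) : ℤ) ω = y} := by
      ext ω
      simp [Prod.ext_iff]
    obtain ⟨d, rfl⟩ : ∃ d, j = i + 1 + d := ⟨j - i - 1, by omega⟩
    have hd : i + 1 + d - i - 1 = d := by omega
    rw [hset, hd]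
    have h5 := abs_measureReal_inter_sub_le (μ := μ) hX (i := ((i * k + k - 1 : ℕ) : ℤ))
      (j := (((i + 1 + d) * k : ℕ) : ℤ)) (s := d) (by
        have : d ≤ d * k := Nat.le_mul_of_pos_right d hk
        have h6 : (i + 1 + d) * k = i * k + k + d * k := by ring
        omega)
      (measurableSet_past_read (a := ((i * k : ℕ) : ℤ)) (by omega) x)
      (measurableSet_future_read (le_refl _) y)
    rw [measureReal_read_eq hX hstat k _ 0, measureReal_read_eq hX hstat k _ 0 y] at h5
    refine h5.trans ?_
    exact mul_le_of_le_one_left (mixingCoeff_nonneg _) measureReal_le_one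
  -- The value `1` at `0` covers the diagonal; the index `s - 1` appears because adjacent blocks
  -- have no block between them.
  set c : ℕ → ℝ := fun s => if s = 0 then 1 else mixingCoeff X μ (s - 1) with hc
  have hc0 : ∀ s, 0 ≤ c s := by
    intro s
    simp only [hc]
    split_ifs
    exacts [zero_le_one, mixingCoeff_nonneg _]
  have hcs : Summable c := by
    rw [← summable_nat_add_iff 1]
    simpa [hc] using hmix
  have hcov : ∀ i j : ℕ, ∫ ω, W i ω * W j ω ∂μ ≤ K * c ((j : ℤ) - i).natAbs := by
    intro i j
    rcases lt_trichotomy i j with h | h | h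
    · refine (hoff i j h).trans (le_of_eq ?_)
      simp only [hc]
      rw [if_neg (by omega), show ((j : ℤ) - i).natAbs - 1 = j - i - 1 by omega]
    · subst h
      simpa [hc] using hdiag i
    · simp_rw [mul_comm (W i _)]
      refine (hoff j i h).trans (le_of_eq ?_)
      simp only [hc]
      rw [if_neg (by omega), show ((j : ℤ) - i).natAbs - 1 = i - j - 1 by omega]
  have hvar : ∀ m : ℕ, ∫ ω, (∑ j ∈ Finset.range m, W j ω) ^ 2 ∂μ ≤ m * (K * (2 * ∑' s, c s)) := by
    intro m
    have h1 : ∀ ω, (∑ j ∈ Finset.range m, W j ω) ^ 2 =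
        ∑ i ∈ Finset.range m, ∑ j ∈ Finset.range m, W i ω * W j ω := fun ω => by
      rw [sq, Finset.sum_mul_sum]
    simp_rw [h1]
    rw [integral_finsetSum _ fun i _ => integrable_finsetSum _ fun j _ => hint i j]
    have h2 : ∀ i ∈ Finset.range m, ∫ ω, ∑ j ∈ Finset.range m, W i ω * W j ω ∂μ ≤
        K * (2 * ∑' s, c s) := by
      intro i _
      rw [integral_finsetSum _ fun j _ => hint i j]
      refine (Finset.sum_le_sum fun j _ => hcov i j).trans ?_
      rw [← Finset.mul_sum]
      refine mul_le_mul_of_nonneg_left ?_ hK0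
      have h3 := sum_natAbs_sub_le ((Finset.range m).map Nat.castEmbedding) i hc0 hcs
      simpa using h3
    refine (Finset.sum_le_sum h2).trans ?_
    simp
  have hbound : ∀ᶠ m : ℕ in atTop, μ.real {ω | m * e + m * η ≤
      ∑ j ∈ Finset.range m, f (read X k ((j * k : ℕ) : ℤ) ω)} ≤
      K * (2 * ∑' s, c s) / η ^ 2 / m := by
    filter_upwards [eventually_gt_atTop 0] with m hm
    have hm' : (0 : ℝ) < m := by exact_mod_cast hm
    -- Chebyshev's inequality: the second moment is `O(m)` against the squared threshold `(m * η) ^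
    -- 2`.
    have h1 := mul_meas_ge_le_integral_of_nonneg (μ := μ)
      (f := fun ω => (∑ j ∈ Finset.range m, W j ω) ^ 2)
      (ae_of_all _ fun ω => sq_nonneg _) (by
        simp_rw [sq, Finset.sum_mul_sum]
        exact integrable_finsetSum _ fun i _ => integrable_finsetSum _ fun j _ => hint i j)
      ((m * η) ^ 2)
    have h2 : μ.real {ω | m * e + m * η ≤
        ∑ j ∈ Finset.range m, f (read X k ((j * k : ℕ) : ℤ) ω)} ≤
        μ.real {ω | (m * η) ^ 2 ≤ (∑ j ∈ Finset.range m, W j ω) ^ 2} := by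
      refine measureReal_mono fun ω hω => ?_
      simp only [Set.mem_ofPred_eq] at hω ⊢
      refine pow_le_pow_left₀ (by positivity) ?_ 2
      simp only [hW, hg, Finset.sum_sub_distrib, Finset.sum_const, Finset.card_range,
        nsmul_eq_mul]
      linarith
    have h3 := h1.trans (hvar m)
    rw [div_div, le_div_iff₀ (by positivity)]
    have h4 : (m * η) ^ 2 * μ.real {ω | m * e + m * η ≤
        ∑ j ∈ Finset.range m, f (read X k ((j * k : ℕ) : ℤ) ω)} ≤ m * (K * (2 * ∑' s, c s)) :=
      (mul_le_mul_of_nonneg_left h2 (by positivity)).trans h3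
    refine le_of_mul_le_mul_left ?_ hm'
    refine le_trans (le_of_eq ?_) h4
    ring
  refine squeeze_zero' (Eventually.of_forall fun m => measureReal_nonneg) hbound ?_
  exact tendsto_const_nhds.div_atTop tendsto_natCast_atTop_atTop

lemma windowPMF_eq (hX : ∀ i, Measurable (X i)) (hstat : IsStationaryErgodic X μ) (t : ℕ)
    (a : ℤ) (x : Fin (2 * t + 1) → A) :
    windowPMF X μ t x = μ.real {ω | read X (2 * t + 1) a ω = x} :=
  measureReal_read_eq hX hstat _ _ _ _

lemma one_lt_card (hX : ∀ i, Measurable (X i)) (hstat : IsStationaryErgodic X μ)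
    (hmix : Tendsto (mixingCoeff X μ) atTop (𝓝 0)) (haper : recurrenceProb X μ < 1) :
    1 < Fintype.card A := by
  by_contra h
  have hsub : Subsingleton A := Fintype.card_le_one_iff_subsingleton.1 (not_lt.1 h)
  obtain ⟨ω⟩ : Nonempty Ω := nonempty_of_isProbabilityMeasure μ
  have h1 := sq_measureReal_preimage_le hX hstat hmix 0 (X 0 ω)
  have h2 : X 0 ⁻¹' {X 0 ω} = Set.univ := by
    ext ω'
    simp [eq_iff_true_of_subsingleton]
  rw [h2, probReal_univ] at h1
  linarith

/-- Every word of length `τ` has probability at most `r ^ (τ / g)`, so the entropy rate is at least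
`-logb b r / g`. -/
lemma shannonRate_pos (hX : ∀ i, Measurable (X i)) (hstat : IsStationaryErgodic X μ)
    (hmix : Tendsto (mixingCoeff X μ) atTop (𝓝 0)) (haper : recurrenceProb X μ < 1)
    {H : ℝ} (hH : HasShannonRate X μ H) : 0 < H := by
  obtain ⟨g, r, hg, hr0, hr1, hword, -⟩ := exists_exponential_bounds hX hstat hmix haper
  have hb : (1 : ℝ) < Fintype.card A := by exact_mod_cast one_lt_card hX hstat hmix haper
  set b : ℝ := (Fintype.card A : ℝ)
  have hlam : 0 < -Real.logb b r := neg_pos.2 (Real.logb_neg hb hr0 hr1)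
  have hg' : (0 : ℝ) < g := by exact_mod_cast hg
  have hτ : Tendsto (fun t : ℕ => 2 * (t : ℝ) + 1) atTop atTop :=
    tendsto_atTop_add_const_right _ _ (tendsto_natCast_atTop_atTop.const_mul_atTop two_pos)
  have hlow : ∀ t : ℕ, (1 / (g : ℝ) - 1 / (2 * (t : ℝ) + 1)) * (-Real.logb b r) ≤
      shannonEntropy b (windowPMF X μ t) / (2 * (t : ℝ) + 1) := by
    intro t
    have hτ0 : (0 : ℝ) < 2 * (t : ℝ) + 1 := by positivity
    rw [le_div_iff₀ hτ0]
    have h1 : (((2 * t + 1) / g : ℕ) : ℝ) * (-Real.logb b r) ≤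
        shannonEntropy b (windowPMF X μ t) := by
      have hsum : ∑ x, windowPMF X μ t x = 1 :=
        sum_measureReal_eq_one (measurable_read hX (2 * t + 1) (-(t : ℤ)))
      rw [shannonEntropy, ← Finset.sum_neg_distrib]
      calc (((2 * t + 1) / g : ℕ) : ℝ) * (-Real.logb b r)
          = ∑ x, windowPMF X μ t x * ((((2 * t + 1) / g : ℕ) : ℝ) * (-Real.logb b r)) := by
            rw [← Finset.sum_mul, hsum, one_mul]
        _ ≤ _ := by
            refine Finset.sum_le_sum fun x _ => ?_
            have h0 : 0 ≤ windowPMF X μ t x := measureReal_nonneg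
            rcases h0.eq_or_lt with h0 | h0
            · simp [← h0]
            rw [← mul_neg]
            refine mul_le_mul_of_nonneg_left ?_ h0.le
            have h2 := Real.logb_le_logb_of_le hb h0 (hword (2 * t + 1) (-(t : ℤ)) x)
            rw [Real.logb_pow] at h2
            linarith
    refine le_trans ?_ h1
    have h2 : (2 * (t : ℝ) + 1) / g - 1 ≤ (((2 * t + 1) / g : ℕ) : ℝ) := by
      have := Nat.lt_floor_add_one ((2 * (t : ℝ) + 1) / g)
      have h3 : ⌊(2 * (t : ℝ) + 1) / g⌋₊ = (2 * t + 1) / g := by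
        rw [← Nat.floor_div_eq_div (K := ℝ)]
        push_cast
        rfl
      rw [h3] at this
      linarith
    calc _ = ((2 * (t : ℝ) + 1) / g - 1) * (-Real.logb b r) := by field_simp
      _ ≤ _ := mul_le_mul_of_nonneg_right h2 hlam.le
  have hlim : Tendsto (fun t : ℕ => (1 / (g : ℝ) - 1 / (2 * (t : ℝ) + 1)) * (-Real.logb b r))
      atTop (𝓝 ((1 / (g : ℝ) - 0) * (-Real.logb b r))) :=
    (tendsto_const_nhds.sub (tendsto_const_nhds.div_atTop hτ)).mul_const _
  have := le_of_tendsto_of_tendsto' hlim hH hlow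
  refine lt_of_lt_of_le ?_ this
  rw [sub_zero]
  positivity

/-- The information of a long string is at most its entropy rate, in probability. -/
lemma tendsto_measureReal_windowPMF_lt (hX : ∀ i, Measurable (X i))
    (hstat : IsStationaryErgodic X μ) (hmix : Summable (mixingCoeff X μ))
    (hb : (1 : ℝ) < Fintype.card A) {H : ℝ} (hH0 : 0 < H) (hH : HasShannonRate X μ H) {η : ℝ}
    (hη : 0 < η) :
    Tendsto (fun t : ℕ => μ.real {ω | windowPMF X μ t (read X (2 * t + 1) 0 ω) <
      (Fintype.card A : ℝ) ^ (-((2 * (t : ℝ) + 1) * (H + η)))}) atTop (𝓝 0) := by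
  set b : ℝ := (Fintype.card A : ℝ) with hbdef
  have hb0 : 0 < b := by linarith
  -- One block length `k` is fixed whose entropy per symbol is already below `H + η / 4`; the long
  -- window is compared with independent blocks of this length.
  obtain ⟨u, hu⟩ := (hH.eventually (gt_mem_nhds (show H < H + η / 4 by linarith))).exists
  set k := 2 * u + 1 with hk
  have hk0 : 0 < k := by omega
  have hk0' : (0 : ℝ) < k := by exact_mod_cast hk0
  set P : (Fin k → A) → ℝ := fun x => μ.real {ω | read X k 0 ω = x} with hP
  set e := ∑ x, P x * (-Real.logb b (P x)) with he
  have hek : e ≤ k * (H + η / 4) := by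
    have h1 : shannonEntropy b (windowPMF X μ u) = e := by
      rw [shannonEntropy, he, ← Finset.sum_neg_distrib]
      refine Finset.sum_congr rfl fun x _ => ?_
      rw [windowPMF_eq hX hstat u 0, mul_neg]
    rw [h1, div_lt_iff₀ (by positivity)] at hu
    rw [hk]
    push_cast
    linarith
  -- Rounding up makes the blocks cover the window, so the window word is at least as likely as the
  -- block sequence.
  set m : ℕ → ℕ := fun t => (2 * t + 1) / k + 1 with hm
  have hmlow : ∀ t, 2 * t + 1 ≤ m t * k := fun t => by
    have := Nat.lt_div_mul_add (a := 2 * t + 1) hk0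
    simp only [hm, add_mul, one_mul]
    omega
  have hmup : ∀ t, m t * k ≤ 2 * t + 1 + k := fun t => by
    have := Nat.div_mul_le_self (2 * t + 1) k
    simp only [hm, add_mul, one_mul]
    omega
  have hmtop : Tendsto m atTop atTop := by
    refine tendsto_atTop.2 fun N => ?_
    filter_upwards [eventually_ge_atTop (N * k)] with t ht
    have h1 := hmlow t
    by_contra h
    have h2 : m t * k ≤ N * k := Nat.mul_le_mul_right k (by omega)
    omega
  have hwlln := (tendsto_measureReal_block_sum hX hstat hmix hk0 (fun x => -Real.logb b (P x))
    (show 0 < k * (η / 4) by positivity)).comp hmtop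
  set Y : (n : ℕ) → Ω → Fin n → Fin k → A :=
    fun n ω j => read X k (((j : ℕ) * k : ℕ) : ℤ) ω with hY
  have hYm : ∀ n, Measurable (Y n) := fun n => measurable_pi_lambda _ fun _ => measurable_read hX _ _
  set R : (n : ℕ) → (Fin n → Fin k → A) → ℝ := fun n y => μ.real {ω | Y n ω = y} with hR
  set C : ℕ → ℝ := fun t => b ^ (-((m t : ℝ) * (k * (η / 4)))) with hC
  have hC0 : Tendsto C atTop (𝓝 0) := by
    have h1 : Tendsto (fun t => (m t : ℝ) * (k * (η / 4))) atTop atTop :=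
      (tendsto_natCast_atTop_atTop.comp hmtop).atTop_mul_const (by positivity)
    simp only [hC]
    exact (tendsto_rpow_atBot_of_base_gt_one b hb).comp (tendsto_neg_atTop_atBot.comp h1)
  -- Change of measure: where the true law `R` is at most `C t` times the product law, its total
  -- mass is at most `C t`.
  have hfirst : ∀ t, μ.real {ω | R (m t) (Y (m t) ω) ≤ (∏ j, P (Y (m t) ω j)) * C t} ≤ C t := by
    intro t
    classical
    rw [measureReal_mem_eq_sum (hYm (m t)) fun y => R (m t) y ≤ (∏ j, P (y j)) * C t]
    have hCt : 0 ≤ C t := (Real.rpow_pos_of_pos hb0 _).le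
    calc _ ≤ ∑ y with R (m t) y ≤ (∏ j, P (y j)) * C t, (∏ j, P (y j)) * C t :=
          Finset.sum_le_sum fun y hy => (Finset.mem_filter.1 hy).2
      _ ≤ ∑ y : Fin (m t) → Fin k → A, (∏ j, P (y j)) * C t :=
          Finset.sum_le_sum_of_subset_of_nonneg (Finset.filter_subset _ _) fun y _ _ =>
            mul_nonneg (Finset.prod_nonneg fun _ _ => measureReal_nonneg) hCt
      _ = C t := by
          rw [← Finset.sum_mul, ← Fintype.prod_sum (fun _ : Fin (m t) => P)]
          have : ∑ x, P x = 1 := sum_measureReal_eq_one (measurable_read hX k 0)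
          simp [this]
  have hτ : Tendsto (fun t : ℕ => 2 * (t : ℝ) + 1) atTop atTop :=
    tendsto_atTop_add_const_right _ _ (tendsto_natCast_atTop_atTop.const_mul_atTop two_pos)
  have hsum := hC0.add hwlln
  rw [add_zero] at hsum
  refine squeeze_zero' (Eventually.of_forall fun m => measureReal_nonneg) ?_ hsum
  -- The block sequence has information rate at most `H + 3 * η / 4`; the last `η / 4` must absorb
  -- the overshoot of at most `k` symbols.
  filter_upwards [hτ.eventually_ge_atTop (k * (H + 3 * η / 4) / (η / 4))] with t ht
  rw [div_le_iff₀ (by positivity)] at ht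
  refine le_trans (measureReal_mono (s₂ := {ω | R (m t) (Y (m t) ω) ≤
    (∏ j, P (Y (m t) ω j)) * C t} ∪ {ω | m t * e + m t * (k * (η / 4)) ≤
      ∑ j ∈ Finset.range (m t), -Real.logb b (P (read X k ((j * k : ℕ) : ℤ) ω))}) ?_)
    ((measureReal_union_le _ _).trans (add_le_add (hfirst t) le_rfl))
  intro ω hω
  by_contra hnot
  simp only [Set.mem_union, Set.mem_ofPred_eq, not_or, not_le] at hnot hω
  obtain ⟨h1, h2⟩ := hnot
  have hprod0 : 0 ≤ ∏ j, P (Y (m t) ω j) := Finset.prod_nonneg fun _ _ => measureReal_nonneg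
  have hCt : 0 < C t := Real.rpow_pos_of_pos hb0 _
  have hRpos : 0 < R (m t) (Y (m t) ω) := lt_of_le_of_lt (mul_nonneg hprod0 hCt.le) h1
  -- Positivity is needed because `Real.logb b 0 = 0` would hide a block of probability zero.
  have hPpos : ∀ j, 0 < P (Y (m t) ω j) := by
    intro j
    refine hRpos.trans_le ?_
    simp only [hP]
    rw [← measureReal_read_eq hX hstat k (((j : ℕ) * k : ℕ) : ℤ) 0]
    exact measureReal_mono fun ω' hω' => congrFun hω' j
  have hQ : ∏ j, P (Y (m t) ω j) =
      b ^ (-∑ j ∈ Finset.range (m t), -Real.logb b (P (read X k ((j * k : ℕ) : ℤ) ω))) := by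
    rw [← Finset.sum_neg_distrib, Finset.sum_range, Real.rpow_sum_of_pos hb0]
    refine Finset.prod_congr rfl fun j _ => ?_
    rw [neg_neg, Real.rpow_logb hb0 hb.ne' (hPpos j)]
  have hwin : R (m t) (Y (m t) ω) ≤ windowPMF X μ t (read X (2 * t + 1) 0 ω) := by
    rw [windowPMF_eq hX hstat t 0]
    refine measureReal_mono fun ω' hω' => ?_
    funext i
    have hi : (i : ℕ) / k < m t := by
      rw [Nat.div_lt_iff_lt_mul hk0]
      exact lt_of_lt_of_le i.2 (hmlow t)
    have h3 := congrFun (congrFun hω' ⟨i / k, hi⟩) ⟨i % k, Nat.mod_lt _ hk0⟩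
    have h4 : (((i : ℕ) / k * k : ℕ) : ℤ) + (((i : ℕ) % k : ℕ) : ℤ) = 0 + ((i : ℕ) : ℤ) := by
      rw [zero_add]
      exact_mod_cast Nat.div_add_mod' (i : ℕ) k
    simp only [hY, read, h4] at h3
    exact h3
  have hlast : b ^ (-((2 * (t : ℝ) + 1) * (H + η))) ≤ (∏ j, P (Y (m t) ω j)) * C t := by
    rw [hQ, hC, ← Real.rpow_add hb0]
    refine Real.rpow_le_rpow_of_exponent_le hb.le ?_
    have h5 : (m t : ℝ) * k ≤ 2 * t + 1 + k := by exact_mod_cast hmup t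
    have h6 : (m t : ℝ) * e ≤ m t * (k * (H + η / 4)) :=
      mul_le_mul_of_nonneg_left hek (Nat.cast_nonneg _)
    have h7 : (m t : ℝ) * k * (H + 3 * η / 4) ≤ (2 * t + 1 + k) * (H + 3 * η / 4) :=
      mul_le_mul_of_nonneg_right h5 (by positivity)
    nlinarith
  linarith

/-- The lower half of the asymptotic equipartition property. -/
lemma tendsto_measureReal_lt_windowPMF (hX : ∀ i, Measurable (X i))
    (hstat : IsStationaryErgodic X μ) (hrenyi : minusInfRate X μ < ⊤)
    (hmix : Summable (mixingCoeff X μ))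
    (hb : (1 : ℝ) < Fintype.card A) {H : ℝ} (hH0 : 0 < H) (hH : HasShannonRate X μ H) {ε : ℝ}
    (hε : 0 < ε) :
    Tendsto (fun t : ℕ => μ.real {ω | (Fintype.card A : ℝ) ^ (-((2 * (t : ℝ) + 1) * (H - ε))) <
      windowPMF X μ t (read X (2 * t + 1) 0 ω)}) atTop (𝓝 0) := by
  classical
  have hupper := fun η hη =>
    tendsto_measureReal_windowPMF_lt (η := η) hX hstat hmix hb hH0 hH hη
  set b : ℝ := (Fintype.card A : ℝ) with hbdef
  have hb0 : 0 < b := by linarith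
  obtain ⟨C, hC0, hC⟩ : ∃ C : ℝ, 0 ≤ C ∧ ∀ᶠ t : ℕ in atTop, ∀ x, windowPMF X μ t x ≠ 0 →
      -Real.logb b (windowPMF X μ t x) ≤ C * (2 * t + 1) := by
    obtain ⟨C, hC, -⟩ := EReal.lt_iff_exists_real_btwn.1 hrenyi
    refine ⟨max C 0, le_max_right _ _, ?_⟩
    filter_upwards [eventually_lt_of_limsup_lt hC] with t ht x hx
    have ht' : minusInfEntropy b (windowPMF X μ t) / (2 * (t : ℝ) + 1) < C := by
      exact_mod_cast ht
    have hτ0 : (0 : ℝ) < 2 * t + 1 := by positivity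
    rw [div_lt_iff₀ hτ0, minusInfEntropy] at ht'
    have hfin : (windowPMF X μ t '' Function.support (windowPMF X μ t)).Finite :=
      Set.toFinite _
    have hmem : windowPMF X μ t x ∈ windowPMF X μ t '' Function.support (windowPMF X μ t) :=
      ⟨x, hx, rfl⟩
    have hle := csInf_le hfin.bddBelow hmem
    obtain ⟨y, hy, hy'⟩ := Set.Nonempty.csInf_mem ⟨_, hmem⟩ hfin
    have hpos : 0 < sInf (windowPMF X μ t '' Function.support (windowPMF X μ t)) := by
      rw [← hy']
      exact lt_of_le_of_ne measureReal_nonneg (Ne.symm hy)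
    have h1 := Real.logb_le_logb_of_le hb hpos hle
    have h2 : C * (2 * (t : ℝ) + 1) ≤ max C 0 * (2 * t + 1) :=
      mul_le_mul_of_nonneg_right (le_max_left _ _) hτ0.le
    linarith
  have hmain : ∀ η : ℝ, 0 < η → ∀ᶠ t : ℕ in atTop,
      μ.real {ω | b ^ (-((2 * (t : ℝ) + 1) * (H - ε))) <
        windowPMF X μ t (read X (2 * t + 1) 0 ω)} ≤
      (H + η - shannonEntropy b (windowPMF X μ t) / (2 * (t : ℝ) + 1) +
        C * μ.real {ω | windowPMF X μ t (read X (2 * t + 1) 0 ω) <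
          b ^ (-((2 * (t : ℝ) + 1) * (H + η)))}) / ε := by
    intro η hη
    filter_upwards [hC] with t ht
    have hτ0 : (0 : ℝ) < 2 * t + 1 := by positivity
    set τ : ℝ := 2 * (t : ℝ) + 1 with hτ
    set P := windowPMF X μ t with hP
    have hU := measurable_read hX (2 * t + 1) 0
    have hPx : ∀ x, P x = μ.real {ω | read X (2 * t + 1) 0 ω = x} := windowPMF_eq hX hstat t 0
    have hsum : ∑ x, P x = 1 := by
      simp_rw [hPx]
      exact sum_measureReal_eq_one hU
    rw [measureReal_mem_eq_sum hU fun x => b ^ (-(τ * (H - ε))) < P x,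
      measureReal_mem_eq_sum hU fun x => P x < b ^ (-(τ * (H + η))), le_div_iff₀ hε]
    simp_rw [← hPx]
    -- Averaging a pointwise bound: the information is at most `τ * (H + η)`, except on very
    -- unlikely words, where it is at most `C * τ`; too likely words save a further `ε * τ`.
    have hent : shannonEntropy b P ≤ τ * (H + η) +
        C * τ * (∑ x with P x < b ^ (-(τ * (H + η))), P x) -
        ε * τ * ∑ x with b ^ (-(τ * (H - ε))) < P x, P x := by
      have h1 : τ * (H + η) = ∑ x, P x * (τ * (H + η)) := by rw [← Finset.sum_mul, hsum, one_mul]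
      suffices h : shannonEntropy b P ≤ ∑ x, P x * (τ * (H + η)) +
          C * τ * (∑ x with P x < b ^ (-(τ * (H + η))), P x) -
          ε * τ * ∑ x with b ^ (-(τ * (H - ε))) < P x, P x by rwa [← h1] at h
      rw [Finset.sum_filter, Finset.sum_filter, Finset.mul_sum, Finset.mul_sum,
        ← Finset.sum_add_distrib, ← Finset.sum_sub_distrib, shannonEntropy,
        ← Finset.sum_neg_distrib]
      refine Finset.sum_le_sum fun x _ => ?_
      have h0 : 0 ≤ P x := measureReal_nonneg
      rcases h0.eq_or_lt with h0 | h0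
      · simp [← h0]
      have hG : b ^ (-(τ * (H - ε))) < P x → -Real.logb b (P x) ≤ τ * (H - ε) := fun h => by
        have := (Real.le_logb_iff_rpow_le hb h0).2 h.le
        linarith
      have hnB : ¬ P x < b ^ (-(τ * (H + η))) → -Real.logb b (P x) ≤ τ * (H + η) := fun h => by
        have := (Real.le_logb_iff_rpow_le hb h0).2 (not_lt.1 h)
        linarith
      have hlt : b ^ (-(τ * (H + η))) < b ^ (-(τ * (H - ε))) := by
        refine Real.rpow_lt_rpow_of_exponent_lt hb ?_
        nlinarith
      have hCx := ht x h0.ne'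
      split_ifs with h2 h3 h3
      · linarith
      · have : 0 ≤ P x * (τ * (H + η)) := by positivity
        nlinarith
      · nlinarith [hG h3, mul_pos h0 (mul_pos hτ0 hη)]
      · nlinarith [hnB h2]
    have h2 : shannonEntropy b P / τ ≤ (H + η) +
        C * (∑ x with P x < b ^ (-(τ * (H + η))), P x) -
        ε * ∑ x with b ^ (-(τ * (H - ε))) < P x, P x := by
      rw [div_le_iff₀ hτ0]
      refine hent.trans (le_of_eq ?_)
      ring
    linarith
  refine tendsto_order.2 ⟨fun a ha => Eventually.of_forall fun t => ha.trans_le measureReal_nonneg,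
    fun ζ hζ => ?_⟩
  -- With this `η` the limit of the bound is `ζ / 2`.
  have hη : 0 < ζ * ε / 2 := by positivity
  have hlim := (((tendsto_const_nhds (x := H + ζ * ε / 2)).sub hH).add
    ((hupper _ hη).const_mul C)).div_const ε
  have hval : (H + ζ * ε / 2 - H + C * 0) / ε < ζ := by
    rw [div_lt_iff₀ hε]
    nlinarith
  filter_upwards [hmain _ hη, hlim.eventually (gt_mem_nhds hval)] with t h1 h2
  exact h1.trans_lt h2

end Entropy

/-! ### Coincidences of words at distant positions -/

section Coincidence

variable {Ω A : Type*} [MeasurableSpace Ω] [Fintype A] [MeasurableSpace A]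
  [MeasurableSingletonClass A] {μ : Measure Ω} [IsProbabilityMeasure μ] {X : ℤ → Ω → A}

/-- The substrings of length `τ` at positions `a` and `b` are equal, and belong to `W`. -/
def coincidence (X : ℤ → Ω → A) {τ : ℕ} (W : Set (Fin τ → A)) (a b : ℤ) : Set Ω :=
  {ω | read X τ a ω = read X τ b ω ∧ read X τ a ω ∈ W}

lemma coincidence_comm {τ : ℕ} (W : Set (Fin τ → A)) (a b : ℤ) :
    coincidence X W a b = coincidence X W b a := by
  ext ω
  simp only [coincidence, Set.mem_ofPred_eq]
  constructor <;> rintro ⟨h1, h2⟩ <;> exact ⟨h1.symm, h1 ▸ h2⟩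

/-- Given the earlier word `x`, its repetition after the gap has probability at most `θ` plus the
mixing coefficient; averaging over `x` in `W` keeps this bound. -/
lemma measureReal_coincidence_le (hX : ∀ i, Measurable (X i)) {τ : ℕ} {W : Set (Fin τ → A)}
    {θ : ℝ} (hθ0 : 0 ≤ θ) (hθ : ∀ a : ℤ, ∀ x ∈ W, μ.real {ω | read X τ a ω = x} ≤ θ) {a b : ℤ}
    (hab : τ ≤ (b - a).natAbs) :
    μ.real (coincidence X W a b) ≤ mixingCoeff X μ ((b - a).natAbs - τ) + θ := by
  classical
  wlog hle : a ≤ b generalizing a b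
  · rw [coincidence_comm, ← Int.natAbs_neg, neg_sub]
    exact this (by omega) (by omega)
  set d := mixingCoeff X μ ((b - a).natAbs - τ)
  have hsub : coincidence X W a b ⊆
      ⋃ x ∈ Finset.univ.filter (· ∈ W), {ω | read X τ a ω = x} ∩ {ω | read X τ b ω = x} := by
    rintro ω ⟨h1, h2⟩
    simp only [Finset.mem_filter, Finset.mem_univ, true_and, Set.mem_iUnion]
    exact ⟨_, h2, rfl, h1.symm⟩
  refine (measureReal_mono hsub (measure_ne_top _ _)).trans
    ((measureReal_biUnion_finset_le _ _).trans ?_)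
  calc ∑ x with x ∈ W, μ.real ({ω | read X τ a ω = x} ∩ {ω | read X τ b ω = x})
      ≤ ∑ x with x ∈ W, μ.real {ω | read X τ a ω = x} * (θ + d) := by
        refine Finset.sum_le_sum fun x hx => ?_
        have h := measureReal_inter_le (μ := μ) hX (i := a + τ) (j := b)
          (s := (b - a).natAbs - τ) (by omega) (measurableSet_past_read (a := a) (by omega) x)
          (measurableSet_future_read (le_refl _) x)
        refine h.trans (mul_le_mul_of_nonneg_left ?_ measureReal_nonneg)
        have := hθ b x (Finset.mem_filter.1 hx).2
        linarith
    _ = μ.real {ω | read X τ a ω ∈ W} * (θ + d) := by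
        rw [← Finset.sum_mul, measureReal_mem_eq_sum (measurable_read hX τ a) (· ∈ W)]
    _ ≤ d + θ := by
        rw [add_comm d]
        exact mul_le_of_le_one_left (add_nonneg hθ0 (mixingCoeff_nonneg _)) measureReal_le_one

end Coincidence

/-! ### The detector and its error events -/

section Detector

lemma signedOverlap_mem (l : ℕ) (i j : ℤ) : signedOverlap l i j ∈ overlapValues l := by
  simp only [signedOverlap, overlapValues, Finset.mem_insert, Finset.mem_Icc]
  split_ifs <;> omega

lemma signedOverlap_eq_sub (l : ℕ) (i j : ℤ) : signedOverlap l i j = signedOverlap l 0 (j - i) := by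
  simp only [signedOverlap]
  split_ifs <;> omega

lemma card_secondWindow_le (n l : ℕ) (i : ℤ) : (secondWindow n l i).card ≤ n := by
  unfold secondWindow
  split_ifs <;> rw [Int.card_Icc] <;> omega

variable {Ω A : Type*}

/-- The reads `R₁`, `R₂` look as if the second one started `s` positions after the first one: the
first `τ` symbols of the overlap agree and form a string of `W`. -/
def IsShift {l τ : ℕ} (W : Set (Fin τ → A)) (R₁ R₂ : Fin l → A) (s : ℤ) : Prop :=
  |s| + τ ≤ l ∧ ∃ v ∈ W, ∀ j : Fin τ,
    (∀ k : Fin l, ((k : ℕ) : ℤ) = max 0 s + (j : ℕ) → R₁ k = v j) ∧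
    ∀ k : Fin l, ((k : ℕ) : ℤ) = max 0 (-s) + (j : ℕ) → R₂ k = v j

open Classical in
/-- The detector that returns the overlap of some apparent shift, and `0` if there is none. -/
def shiftDetector (l : ℕ) {τ : ℕ} (W : Set (Fin τ → A)) : Detector A l := fun R₁ R₂ =>
  if h : ∃ s, IsShift W R₁ R₂ s then ⟨signedOverlap l 0 h.choose, signedOverlap_mem _ _ _⟩
  else ⟨0, Finset.mem_insert_self _ _⟩

/-- Under shift `s` the overlap begins at offset `max 0 s` of the first read and `max 0 (-s)` of the
second. The two positions coincide exactly when `s = j - i`. -/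
lemma isShift_read_iff {X : ℤ → Ω → A} {l τ : ℕ} {W : Set (Fin τ → A)} {s : ℤ}
    (hs : |s| + τ ≤ l) (i j : ℤ) (ω : Ω) :
    IsShift W (read X l i ω) (read X l j ω) s ↔
      ω ∈ coincidence X W (i + max 0 s) (j + max 0 (-s)) := by
  have hs1 : max 0 s ≤ |s| := by
    rcases abs_cases s with h | h <;> omega
  have hs2 : max 0 (-s) ≤ |s| := by
    rcases abs_cases s with h | h <;> omega
  constructor
  · rintro ⟨-, v, hv, h⟩
    have h1 : read X τ (i + max 0 s) ω = v := by
      funext k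
      have h := (h k).1 ⟨(max 0 s).toNat + k, by omega⟩ (by push_cast; omega)
      rw [← h]
      simp only [read]
      congr 1
      push_cast
      omega
    have h2 : read X τ (j + max 0 (-s)) ω = v := by
      funext k
      have h := (h k).2 ⟨(max 0 (-s)).toNat + k, by omega⟩ (by push_cast; omega)
      rw [← h]
      simp only [read]
      congr 1
      push_cast
      omega
    exact ⟨h1.trans h2.symm, h1 ▸ hv⟩
  · rintro ⟨h1, h2⟩
    refine ⟨hs, _, h2, fun k => ⟨fun k' hk' => ?_, fun k' hk' => ?_⟩⟩
    · simp only [read, hk', add_assoc]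
    · rw [h1]
      simp only [read, hk', add_assoc]

/-- If no false shift passes, the arbitrary choice in the detector is harmless. The true shift
compares a word with itself and so fails only on an atypical word. Disjoint reads correctly give
`0`. Positive overlaps shorter than `τ` are excluded by `hij`. -/
lemma shiftDetector_ne_subset (X : ℤ → Ω → A) {l τ : ℕ} (hτ : 0 < τ) (W : Set (Fin τ → A))
    {i j : ℤ} (hij : |j - i| + τ ≤ l ∨ l ≤ |j - i|) :
    {ω | (shiftDetector l W (read X l i ω) (read X l j ω) : ℤ) ≠ signedOverlap l i j} ⊆
      {ω | |j - i| ≤ l ∧ read X τ (i + max 0 (j - i)) ω ∉ W} ∪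
      ⋃ s ∈ (Finset.Icc (-(l : ℤ)) l).filter (· ≠ j - i),
        coincidence X W (i + max 0 s) (j + max 0 (-s)) := by
  classical
  intro ω hω
  by_contra hnot
  simp only [Set.mem_union, Set.mem_ofPred_eq, Set.mem_iUnion, not_or, not_and, not_not,
    not_exists, Finset.mem_filter, Finset.mem_Icc] at hnot hω
  obtain ⟨h1, h2⟩ := hnot
  refine hω ?_
  have honly : ∀ s, IsShift W (read X l i ω) (read X l j ω) s → s = j - i := by
    intro s hs
    by_contra hne
    have h3 := abs_le.1 (show |s| ≤ l by have := hs.1; omega)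
    exact h2 s ⟨h3, hne⟩ ((isShift_read_iff hs.1 i j ω).1 hs)
  rw [signedOverlap_eq_sub l i j]
  unfold shiftDetector
  split_ifs with h
  · exact congrArg (signedOverlap l 0) (honly _ h.choose_spec)
  · rcases hij with hij | hij
    · refine absurd ⟨j - i, (isShift_read_iff hij i j ω).2 ⟨?_, h1 (by omega)⟩⟩ h
      congr 1
      omega
    · simp only [signedOverlap]
      rcases abs_cases (j - i) with h3 | h3 <;> split_ifs <;> omega

end Detector

/-! ### Bounds on the error at fixed `n` -/

section ErrorBounds

variable {Ω A : Type*} [MeasurableSpace Ω] [Fintype A] [MeasurableSpace A]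
  [MeasurableSingletonClass A] {μ : Measure Ω} [IsProbabilityMeasure μ] {X : ℤ → Ω → A}

/-- The bound is uniform in the first start, which makes its law `q` irrelevant. -/
lemma optimalError_le_of_detector {n l : ℕ} {q : ℤ → ℝ}
    (hq0 : ∀ i ∈ Finset.Icc 1 (n : ℤ), 0 ≤ q i) (hq1 : ∑ i ∈ Finset.Icc 1 (n : ℤ), q i = 1)
    (D : Detector A l) {B : ℝ}
    (hB : ∀ i : ℤ, ∑ j ∈ secondWindow n l i,
      μ.real {ω | (D (read X l i ω) (read X l j ω) : ℤ) ≠ signedOverlap l i j} ≤ B) :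
    optimalError X μ n l q ≤ B / n := by
  have hbdd : BddBelow (Set.range fun D : Detector A l => errorProb X μ n l q D) := by
    refine ⟨0, ?_⟩
    rintro _ ⟨D, rfl⟩
    exact Finset.sum_nonneg fun i hi => mul_nonneg (hq0 i hi) <| Finset.sum_nonneg fun j _ =>
      mul_nonneg (by positivity) measureReal_nonneg
  refine (ciInf_le hbdd D).trans ?_
  calc errorProb X μ n l q D ≤ ∑ i ∈ Finset.Icc 1 (n : ℤ), q i * (B / n) := by
        refine Finset.sum_le_sum fun i hi => mul_le_mul_of_nonneg_left ?_ (hq0 i hi)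
        rw [← Finset.mul_sum, one_div, div_eq_inv_mul]
        exact mul_le_mul_of_nonneg_left (hB i) (by positivity)
    _ = B / n := by rw [← Finset.sum_mul, hq1, one_mul]

lemma card_filter_abs_sub_lt_le (S : Finset ℤ) (i : ℤ) (l : ℕ) :
    (S.filter fun j => |j - i| < l).card ≤ 2 * l := by
  have h : S.filter (fun j => |j - i| < l) ⊆ Finset.Ioo (i - l) (i + l) := by
    intro j hj
    have := abs_lt.1 (Finset.mem_filter.1 hj).2
    rw [Finset.mem_Ioo]
    omega
  refine (Finset.card_le_card h).trans ?_
  rw [Int.card_Ioo]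
  omega

lemma optimalError_le_two_mul_length {n l : ℕ} {q : ℤ → ℝ}
    (hq0 : ∀ i ∈ Finset.Icc 1 (n : ℤ), 0 ≤ q i) (hq1 : ∑ i ∈ Finset.Icc 1 (n : ℤ), q i = 1) :
    optimalError X μ n l q ≤ 2 * l / n := by
  refine optimalError_le_of_detector hq0 hq1 (fun _ _ => ⟨0, Finset.mem_insert_self _ _⟩)
    fun i => ?_
  calc _ ≤ ∑ j ∈ secondWindow n l i, if |j - i| < l then (1 : ℝ) else 0 := by
        refine Finset.sum_le_sum fun j _ => ?_
        split_ifs with h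
        · exact measureReal_le_one
        · have h0 : signedOverlap l i j = 0 := by
            simp only [signedOverlap]
            rcases abs_cases (j - i) with h3 | h3 <;> split_ifs <;> omega
          simp [h0]
    _ ≤ 2 * l := by
        rw [Finset.sum_boole]
        exact_mod_cast card_filter_abs_sub_lt_le _ _ _

lemma optimalError_le_of_typical (hX : ∀ i, Measurable (X i)) (hstat : IsStationaryErgodic X μ)
    (hmix : Summable (mixingCoeff X μ)) {n l τ : ℕ} {q : ℤ → ℝ}
    (hq0 : ∀ i ∈ Finset.Icc 1 (n : ℤ), 0 ≤ q i) (hq1 : ∑ i ∈ Finset.Icc 1 (n : ℤ), q i = 1)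
    (hτ : 0 < τ) (W : Set (Fin τ → A)) {θ κ : ℝ} (hθ0 : 0 ≤ θ)
    (hθ : ∀ x ∈ W, μ.real {ω | read X τ 0 ω = x} ≤ θ)
    (hκ : ∀ a b : ℤ, a < b → μ.real {ω | read X τ a ω = read X τ b ω} ≤ κ) :
    optimalError X μ n l q ≤ (2 * τ + (2 * l + 1) * (μ.real {ω | read X τ 0 ω ∉ W} +
      (2 * ((2 * τ + 1) * κ + ∑' u, mixingCoeff X μ (u + (τ + 1))) + n * θ))) / n := by
  classical
  have hκ0 : 0 ≤ κ := measureReal_nonneg.trans (hκ 0 1 one_pos)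
  set π := μ.real {ω | read X τ 0 ω ∉ W} with hπ
  have hπ' : ∀ a, μ.real {ω | read X τ a ω ∉ W} = π := fun a => by
    rw [hπ, measureReal_mem_eq_sum (measurable_read hX τ a) (· ∉ W),
      measureReal_mem_eq_sum (measurable_read hX τ 0) (· ∉ W)]
    exact Finset.sum_congr rfl fun x _ => measureReal_read_eq hX hstat _ _ _ _
  -- Cutting at `2 * τ` rather than at `τ` leaves a gap above `τ` beyond the cut, so the mixing
  -- coefficients form a tail that vanishes as `τ` grows.
  set F : ℕ → ℝ := fun u => if u ≤ 2 * τ then κ else mixingCoeff X μ (u - τ) with hF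
  have hF0 : ∀ u, 0 ≤ F u := fun u => by
    simp only [hF]
    split_ifs
    exacts [hκ0, mixingCoeff_nonneg _]
  have hFshift : ∀ u, F (u + (2 * τ + 1)) = mixingCoeff X μ (u + (τ + 1)) := fun u => by
    simp only [hF]
    rw [if_neg (by omega)]
    congr 1
    omega
  have hFs : Summable F := by
    rw [← summable_nat_add_iff (2 * τ + 1)]
    simp_rw [hFshift]
    exact (summable_nat_add_iff (τ + 1)).2 hmix
  have hFsum : ∑' u, F u = (2 * τ + 1) * κ + ∑' u, mixingCoeff X μ (u + (τ + 1)) := by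
    rw [← hFs.sum_add_tsum_nat_add (2 * τ + 1)]
    simp_rw [hFshift]
    congr 1
    rw [Finset.sum_congr rfl (g := fun _ => κ) fun u hu => by
      simp only [hF]
      rw [if_pos (by have := Finset.mem_range.1 hu; omega)]]
    simp
  have hco : ∀ a b : ℤ, a ≠ b → μ.real (coincidence X W a b) ≤ F (b - a).natAbs + θ := by
    intro a b hab
    simp only [hF]
    split_ifs with h
    · have h1 : μ.real (coincidence X W a b) ≤ κ := by
        rcases lt_or_gt_of_ne hab with h | h
        · exact (measureReal_mono fun ω hω => hω.1).trans (hκ a b h)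
        · rw [coincidence_comm]
          exact (measureReal_mono fun ω hω => hω.1).trans (hκ b a h)
      linarith
    · refine measureReal_coincidence_le hX hθ0 (fun a x hx => ?_) (by omega)
      rw [measureReal_read_eq hX hstat τ a 0]
      exact hθ x hx
  refine optimalError_le_of_detector hq0 hq1 (shiftDetector l W) fun i => ?_
  set S := secondWindow n l i with hS
  have hpt : ∀ j, μ.real {ω | (shiftDetector l W (read X l i ω) (read X l j ω) : ℤ) ≠
      signedOverlap l i j} ≤ (if |j - i| < l ∧ (l : ℤ) < |j - i| + τ then 1 else 0) +
      ((if j - i ∈ Finset.Icc (-(l : ℤ)) l then π else 0) +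
      ∑ s ∈ Finset.Icc (-(l : ℤ)) l, (F (j - (i + s)).natAbs + θ)) := by
    intro j
    have hsum0 : 0 ≤ ∑ s ∈ Finset.Icc (-(l : ℤ)) l, (F (j - (i + s)).natAbs + θ) :=
      Finset.sum_nonneg fun s _ => add_nonneg (hF0 _) hθ0
    have hind : 0 ≤ if j - i ∈ Finset.Icc (-(l : ℤ)) l then π else 0 := by
      split_ifs
      exacts [measureReal_nonneg, le_rfl]
    by_cases h : |j - i| < l ∧ (l : ℤ) < |j - i| + τ
    · rw [if_pos h]
      have h1 : μ.real {ω | (shiftDetector l W (read X l i ω) (read X l j ω) : ℤ) ≠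
        signedOverlap l i j} ≤ 1 := measureReal_le_one
      linarith
    · rw [if_neg h, zero_add]
      refine (measureReal_mono (shiftDetector_ne_subset X hτ W (by omega))).trans
        ((measureReal_union_le _ _).trans (add_le_add ?_ ?_))
      · split_ifs with h2
        · rw [← hπ' (i + max 0 (j - i))]
          exact measureReal_mono fun ω hω => hω.2
        · have h3 : ¬ |j - i| ≤ l := fun h3 => h2 (Finset.mem_Icc.2 (abs_le.1 h3))
          simp [h3]
      · refine (measureReal_biUnion_finset_le _ _).trans ?_
        refine (Finset.sum_le_sum fun s hs => ?_).trans
          (Finset.sum_le_sum_of_subset_of_nonneg (Finset.filter_subset _ _) fun s _ _ =>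
            add_nonneg (hF0 _) hθ0)
        have hne := (Finset.mem_filter.1 hs).2
        refine (hco _ _ (by omega)).trans (le_of_eq ?_)
        congr 3
        omega
  refine (Finset.sum_le_sum fun j _ => hpt j).trans ?_
  rw [Finset.sum_add_distrib, Finset.sum_add_distrib]
  have hcardl : ((Finset.Icc (-(l : ℤ)) l).card : ℝ) = 2 * l + 1 := by
    rw [Int.card_Icc]
    have : ((l : ℤ) + 1 - -l).toNat = 2 * l + 1 := by omega
    rw [this]
    push_cast
    ring
  have hA : ∑ j ∈ S, (if |j - i| < l ∧ (l : ℤ) < |j - i| + τ then (1 : ℝ) else 0) ≤ 2 * τ := by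
    rw [Finset.sum_boole]
    have hsub : S.filter (fun j => |j - i| < l ∧ (l : ℤ) < |j - i| + τ) ⊆
        Finset.Ioo (i - l) (i - l + τ) ∪ Finset.Ioo (i + l - τ) (i + l) := by
      intro j hj
      have h1 := (Finset.mem_filter.1 hj).2
      rw [Finset.mem_union, Finset.mem_Ioo, Finset.mem_Ioo]
      rcases abs_cases (j - i) with h3 | h3 <;> omega
    have h1 := (Finset.card_le_card hsub).trans (Finset.card_union_le _ _)
    rw [Int.card_Ioo, Int.card_Ioo] at h1
    have h2 : (S.filter (fun j => |j - i| < l ∧ (l : ℤ) < |j - i| + τ)).card ≤ 2 * τ := by omega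
    exact_mod_cast h2
  have hB : ∑ j ∈ S, (if j - i ∈ Finset.Icc (-(l : ℤ)) l then π else 0) ≤ (2 * l + 1) * π := by
    rw [← Finset.sum_filter, Finset.sum_const, nsmul_eq_mul, ← hcardl]
    refine mul_le_mul_of_nonneg_right ?_ measureReal_nonneg
    have : (S.filter fun j => j - i ∈ Finset.Icc (-(l : ℤ)) l).card ≤
        (Finset.Icc (-(l : ℤ)) l).card :=
      Finset.card_le_card_of_injOn (fun j => j - i)
        (fun j hj => (Finset.mem_filter.1 hj).2) fun x _ y _ hxy => by
          simpa using hxy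
    exact_mod_cast this
  -- Summing over `j` first: for fixed `s` each distance occurs at most twice, so the part with `F`
  -- is bounded independently of `n`.
  have hC : ∑ j ∈ S, ∑ s ∈ Finset.Icc (-(l : ℤ)) l, (F (j - (i + s)).natAbs + θ) ≤
      (2 * l + 1) * (2 * ((2 * τ + 1) * κ + ∑' u, mixingCoeff X μ (u + (τ + 1))) + n * θ) := by
    rw [Finset.sum_comm, ← hcardl, ← nsmul_eq_mul]
    refine Finset.sum_le_card_nsmul _ _ _ fun s _ => ?_
    rw [Finset.sum_add_distrib, ← hFsum]
    refine add_le_add (sum_natAbs_sub_le S (i + s) hF0 hFs) ?_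
    rw [Finset.sum_const, nsmul_eq_mul]
    refine mul_le_mul_of_nonneg_right ?_ hθ0
    exact_mod_cast card_secondWindow_le n l i
  linarith

end ErrorBounds

/-! ### Choice of the test length and asymptotics -/

section Asymptotics

variable {Ω A : Type*} [MeasurableSpace Ω] [Fintype A] [MeasurableSpace A]
  [MeasurableSingletonClass A] {μ : Measure Ω} [IsProbabilityMeasure μ] {X : ℤ → Ω → A}

lemma tendsto_mul_pow_div_zero {g : ℕ} (hg : 0 < g) {r : ℝ} (hr0 : 0 ≤ r) (hr1 : r < 1) :
    Tendsto (fun τ : ℕ => (2 * (τ : ℝ) + 1) * r ^ (τ / g)) atTop (𝓝 0) := by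
  have h1 : Tendsto (fun m : ℕ => 2 * g * ((m : ℝ) * r ^ m) + (2 * g + 1) * r ^ m) atTop
      (𝓝 (2 * g * 0 + (2 * g + 1) * 0)) :=
    ((tendsto_self_mul_const_pow_of_lt_one hr0 hr1).const_mul _).add
      ((tendsto_pow_atTop_nhds_zero_of_lt_one hr0 hr1).const_mul _)
  rw [mul_zero, mul_zero, add_zero] at h1
  refine squeeze_zero (fun τ => by positivity) (fun τ => ?_)
    (h1.comp (Nat.tendsto_div_const_atTop hg.ne'))
  have h2 : (τ : ℝ) ≤ (τ / g : ℕ) * g + g := by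
    exact_mod_cast (Nat.lt_div_mul_add (a := τ) hg).le
  have h3 : 0 ≤ r ^ (τ / g) := pow_nonneg hr0 _
  simp only [Function.comp_apply]
  nlinarith

lemma eventually_optimalError_le_length (hb : (1 : ℝ) < Fintype.card A) {β : ℝ} (hβ : 0 < β)
    {l : ℕ → ℕ} (hl : Tendsto (fun n : ℕ => (l n : ℝ) / Real.logb (Fintype.card A) n) atTop (𝓝 β))
    {q : ℕ → ℤ → ℝ} (hq_nonneg : ∀ n : ℕ, ∀ i ∈ Finset.Icc 1 (n : ℤ), 0 ≤ q n i)
    (hq_sum : ∀ n : ℕ, 1 ≤ n → ∑ i ∈ Finset.Icc 1 (n : ℤ), q n i = 1) {δ : ℝ} (hδ : 0 < δ) :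
    ∀ᶠ n : ℕ in atTop, optimalError X μ n (l n) (q n) ≤
      2 * (1 + δ) * β * (Real.logb (Fintype.card A) n / n) := by
  have hL : Tendsto (fun n : ℕ => Real.logb (Fintype.card A) n) atTop atTop :=
    (Real.tendsto_logb_atTop hb).comp tendsto_natCast_atTop_atTop
  have hlt : β < (1 + δ) * β := by nlinarith
  filter_upwards [hL.eventually_gt_atTop 0, hl.eventually (gt_mem_nhds hlt),
    eventually_ge_atTop 1] with n h1 h2 hn
  have hn' : (0 : ℝ) < n := by exact_mod_cast hn
  refine (optimalError_le_two_mul_length (hq_nonneg n) (hq_sum n hn)).trans ?_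
  rw [div_lt_iff₀ h1] at h2
  rw [← mul_div_assoc]
  refine div_le_div_of_nonneg_right ?_ hn'.le
  linarith

lemma eventually_optimalError_le_entropy (hX : ∀ i, Measurable (X i))
    (hstat : IsStationaryErgodic X μ) (hrenyi : minusInfRate X μ < ⊤)
    (hmix : Summable (mixingCoeff X μ)) (haper : recurrenceProb X μ < 1)
    {H : ℝ} (hH : HasShannonRate X μ H) {β : ℝ} {l : ℕ → ℕ}
    (hl : Tendsto (fun n : ℕ => (l n : ℝ) / Real.logb (Fintype.card A) n) atTop (𝓝 β))
    {q : ℕ → ℤ → ℝ} (hq_nonneg : ∀ n : ℕ, ∀ i ∈ Finset.Icc 1 (n : ℤ), 0 ≤ q n i)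
    (hq_sum : ∀ n : ℕ, 1 ≤ n → ∑ i ∈ Finset.Icc 1 (n : ℤ), q n i = 1) {δ : ℝ} (hδ : 0 < δ) :
    ∀ᶠ n : ℕ in atTop, optimalError X μ n (l n) (q n) ≤
      2 * (1 + δ) * (1 / H) * (Real.logb (Fintype.card A) n / n) := by
  have hmix0 := hmix.tendsto_atTop_zero
  have hb : (1 : ℝ) < Fintype.card A := by exact_mod_cast one_lt_card hX hstat hmix0 haper
  have hH0 : 0 < H := shannonRate_pos hX hstat hmix0 haper hH
  obtain ⟨g, r, hg, hr0, hr1, -, hself⟩ := exists_exponential_bounds hX hstat hmix0 haper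
  -- The test length is about `c * log n`. The choice of `ε` gives `c * (H - ε) = 1 + δ / 4`, hence
  -- `n * θ n ≤ n ^ (-δ / 4)`.
  set c := (1 + δ / 2) / H with hc
  have hc0 : 0 < c := by positivity
  set ε := H * (δ / 4) / (1 + δ / 2) with hε
  have hε0 : 0 < ε := by positivity
  have hcε : c * (H - ε) = 1 + δ / 4 := by
    rw [hc, hε]
    field_simp
    ring
  have hHε : 0 < H - ε := by
    refine pos_of_mul_pos_right (b := H - ε) (a := c) ?_ hc0.le
    rw [hcε]
    positivity
  have haep := tendsto_measureReal_lt_windowPMF hX hstat hrenyi hmix hb hH0 hH hε0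
  set b : ℝ := (Fintype.card A : ℝ) with hbdef
  have hb0 : 0 < b := by linarith
  set L : ℕ → ℝ := fun n => Real.logb b n with hLdef
  have hL : Tendsto L atTop atTop :=
    (Real.tendsto_logb_atTop hb).comp tendsto_natCast_atTop_atTop
  -- The length `2 * T n + 1` is odd, to match the windows of the entropy rate, and lies between `c
  -- * L n` and `c * L n + 3`.
  set T : ℕ → ℕ := fun n => ⌈c * L n / 2⌉₊ with hT
  have hTtop : Tendsto T atTop atTop :=
    tendsto_nat_ceil_atTop.comp ((hL.const_mul_atTop hc0).atTop_div_const two_pos)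
  have hτtop : Tendsto (fun n => 2 * T n + 1) atTop atTop :=
    tendsto_atTop_mono (fun n => by omega) hTtop
  set θ : ℕ → ℝ := fun n => b ^ (-((2 * (T n : ℝ) + 1) * (H - ε))) with hθ
  set G : ℕ → ℝ := fun n => μ.real {ω | θ n < windowPMF X μ (T n) (read X (2 * T n + 1) 0 ω)} +
    (2 * ((2 * ((2 * T n + 1 : ℕ) : ℝ) + 1) * r ^ ((2 * T n + 1) / g) +
      ∑' u, mixingCoeff X μ (u + (2 * T n + 1 + 1))) + n * θ n) with hG
  have hTlow : ∀ n, c * L n ≤ 2 * (T n : ℝ) + 1 := fun n => by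
    have := Nat.le_ceil (c * L n / 2)
    simp only [hT]
    linarith
  have hnθ : Tendsto (fun n : ℕ => n * θ n) atTop (𝓝 0) := by
    have h1 : Tendsto (fun n : ℕ => b ^ (-(δ / 4 * L n))) atTop (𝓝 0) :=
      (tendsto_rpow_atBot_of_base_gt_one b hb).comp
        (tendsto_neg_atTop_atBot.comp (hL.const_mul_atTop (by positivity)))
    refine squeeze_zero' (Eventually.of_forall fun n =>
      mul_nonneg (Nat.cast_nonneg _) (Real.rpow_pos_of_pos hb0 _).le) ?_ h1
    filter_upwards [eventually_ge_atTop 1] with n hn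
    have hn' : (0 : ℝ) < n := by exact_mod_cast hn
    have hbL : (n : ℝ) = b ^ L n := (Real.rpow_logb hb0 hb.ne' hn').symm
    calc (n : ℝ) * θ n = b ^ (L n + -((2 * (T n : ℝ) + 1) * (H - ε))) := by
          rw [Real.rpow_add hb0, ← hbL]
      _ ≤ b ^ (-(δ / 4 * L n)) := by
          refine Real.rpow_le_rpow_of_exponent_le hb.le ?_
          have := mul_le_mul_of_nonneg_right (hTlow n) hHε.le
          have h2 : c * L n * (H - ε) = (1 + δ / 4) * L n := by rw [← hcε]; ring
          linarith
  have hG0 : Tendsto G atTop (𝓝 0) := by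
    have h2 := (tendsto_mul_pow_div_zero hg hr0.le hr1).comp hτtop
    have h3 := (tendsto_sum_nat_add (mixingCoeff X μ)).comp
      (tendsto_atTop_mono (fun n => Nat.le_succ (2 * T n + 1)) hτtop)
    have h4 := (haep.comp hTtop).add (((h2.add h3).const_mul 2).add hnθ)
    simpa [hG, hθ] using h4
  -- This is the numerator of the error bound divided by `L n`; the `6` is twice the rounding loss
  -- `3`.
  have hlim : Tendsto (fun n => 2 * c + 6 * (1 / L n) + (2 * ((l n : ℝ) / L n) + 1 / L n) * G n)
      atTop (𝓝 (2 * c + 6 * 0 + (2 * β + 0) * 0)) := by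
    have h1 : Tendsto (fun n => 1 / L n) atTop (𝓝 0) := tendsto_const_nhds.div_atTop hL
    exact (tendsto_const_nhds.add (h1.const_mul 6)).add (((hl.const_mul 2).add h1).mul hG0)
  have hlt : 2 * c + 6 * 0 + (2 * β + 0) * 0 < 2 * (1 + δ) * (1 / H) := by
    have : c < (1 + δ) * (1 / H) := by
      rw [hc, mul_one_div]
      exact div_lt_div_of_pos_right (by linarith) hH0
    linarith
  filter_upwards [hL.eventually_gt_atTop 0, hlim.eventually (gt_mem_nhds hlt),
    eventually_ge_atTop 1] with n hLn h2 hn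
  have hn' : (0 : ℝ) < n := by exact_mod_cast hn
  have h3 := optimalError_le_of_typical hX hstat hmix (l := l n) (hq_nonneg n) (hq_sum n hn)
    (Nat.succ_pos (2 * T n)) {x | ¬ θ n < windowPMF X μ (T n) x}
    (Real.rpow_pos_of_pos hb0 _).le
    (fun x hx => by
      rw [← windowPMF_eq hX hstat]
      exact not_lt.1 hx) (hself (2 * T n + 1))
  simp only [Set.mem_ofPred_eq, not_not] at h3
  refine h3.trans ?_
  rw [← mul_div_assoc]
  refine div_le_div_of_nonneg_right ?_ hn'.le
  have hTup : ((2 * T n + 1 : ℕ) : ℝ) ≤ c * L n + 3 := by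
    have := Nat.ceil_lt_add_one (show 0 ≤ c * L n / 2 by positivity)
    push_cast
    simp only [hT]
    linarith
  have h4 : 2 * (c * L n + 3) + (2 * l n + 1) * G n =
      (2 * c + 6 * (1 / L n) + (2 * ((l n : ℝ) / L n) + 1 / L n) * G n) * L n := by
    field_simp
    ring
  have h5 := mul_le_mul_of_nonneg_right h2.le hLn.le
  rw [← h4] at h5
  refine le_trans ?_ h5
  exact add_le_add (by linarith) le_rfl

end Asymptotics

end OverlapDetection

end

theorem mainTheorem1 {Ω A : Type*} [MeasurableSpace Ω] [Fintype A] [MeasurableSpace A]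
    [MeasurableSingletonClass A] (μ : Measure Ω) [IsProbabilityMeasure μ]
    (X : ℤ → Ω → A) (hX : ∀ i, Measurable (X i))
    (hstat : OverlapDetection.IsStationaryErgodic X μ)
    (hrenyi : OverlapDetection.minusInfRate X μ < ⊤)
    (hmix : Summable (OverlapDetection.mixingCoeff X μ))
    (haper : OverlapDetection.recurrenceProb X μ < 1)
    (H₁ : ℝ) (hH₁ : OverlapDetection.HasShannonRate X μ H₁)
    (β : ℝ) (hβ : 0 < β) (l : ℕ → ℕ)
    (hl : Tendsto (fun n : ℕ => (l n : ℝ) / Real.logb (Fintype.card A) n) atTop (𝓝 β))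
    (q : ℕ → ℤ → ℝ) (hq_nonneg : ∀ n : ℕ, ∀ i ∈ Finset.Icc 1 (n : ℤ), 0 ≤ q n i)
    (hq_sum : ∀ n : ℕ, 1 ≤ n → ∑ i ∈ Finset.Icc 1 (n : ℤ), q n i = 1) :
    0 < H₁ ∧ ∃ ε : ℕ → ℝ, Tendsto ε atTop (𝓝 0) ∧ ∀ᶠ n : ℕ in atTop,
      OverlapDetection.optimalError X μ n (l n) (q n) ≤
        2 * (1 + ε n) * min β (1 / H₁) * (Real.logb (Fintype.card A) n / n) := by
  have hmix0 := hmix.tendsto_atTop_zero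
  have hb : (1 : ℝ) < Fintype.card A := by
    exact_mod_cast OverlapDetection.one_lt_card hX hstat hmix0 haper
  have hH0 : 0 < H₁ := OverlapDetection.shannonRate_pos hX hstat hmix0 haper hH₁
  refine ⟨hH0, ?_⟩
  have hL : Tendsto (fun n : ℕ => Real.logb (Fintype.card A) n) atTop atTop :=
    (Real.tendsto_logb_atTop hb).comp tendsto_natCast_atTop_atTop
  set M := min β (1 / H₁) with hM
  have hM0 : 0 < M := lt_min hβ (by positivity)
  set e : ℕ → ℝ := fun n => OverlapDetection.optimalError X μ n (l n) (q n) with he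
  set a : ℕ → ℝ := fun n => 2 * M * (Real.logb (Fintype.card A) n / n) with ha
  have hapos : ∀ᶠ n in atTop, 0 < a n := by
    filter_upwards [hL.eventually_gt_atTop 0, eventually_ge_atTop 1] with n h1 hn
    have hn' : (0 : ℝ) < n := by exact_mod_cast hn
    simp only [ha]
    positivity
  have hkey : ∀ δ : ℝ, 0 < δ → ∀ᶠ n in atTop, e n ≤ (1 + δ) * a n := by
    intro δ hδ
    filter_upwards [OverlapDetection.eventually_optimalError_le_length (X := X) (μ := μ) hb hβ hl
      hq_nonneg hq_sum hδ, OverlapDetection.eventually_optimalError_le_entropy hX hstat hrenyi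
      hmix haper hH₁ hl hq_nonneg hq_sum hδ] with n h1 h2
    simp only [ha]
    rcases min_choice β (1 / H₁) with h | h
    · rw [hM, h]
      linarith
    · rw [hM, h]
      linarith
  -- Only an upper bound on `e n / a n` is available, so the excess over `1` is truncated at `0` in
  -- order to converge.
  refine ⟨fun n => max 0 (e n / a n - 1), ?_, ?_⟩
  · refine tendsto_order.2 ⟨fun x hx => Eventually.of_forall fun n => hx.trans_le (le_max_left _ _),
      fun ζ hζ => ?_⟩
    filter_upwards [hkey (ζ / 2) (by positivity), hapos] with n h1 h2
    rw [← div_le_iff₀ h2] at h1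
    exact max_lt hζ (by linarith)
  · filter_upwards [hapos] with n h2
    have h3 : e n / a n ≤ 1 + max 0 (e n / a n - 1) := by
      linarith [le_max_right 0 (e n / a n - 1)]
    rw [div_le_iff₀ h2] at h3
    refine h3.trans (le_of_eq ?_)
    simp only [ha]
    ring
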